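/- Let $(X,\|\cdot\|)$ be a Banach space over $\mathbb{R}$ or $\mathbb{C}$ and let $\tau$ be a Hausdorff locally convex topology on $X$ that is coarser than the norm topology $\tau_{\|\cdot\|}$. A directed system $\Gamma$ of seminorms on $X$ is called norming if $\|x\|=\sup_{p\in\Gamma}p(x)$ for all $x\in X$. Assume that $(X,\|\cdot\|,\tau)$ is a Saks space, i.e. there is a norming directed system of continuous seminorms that generates $\tau$. Let $\gamma=\gamma(\|\cdot\|,\tau)$ be the mixed topology, i.e. the finest linear topology on $X$ with $\tau\subseteq\gamma\subseteq\tau_{\|\cdot\|}$ that coincides with $\tau$ on $\|\cdot\|$-bounded sets, and assume that the Saks space is complete, i.e. that $(X,\gamma)$ is complete. Let $\Gamma_\gamma$ be a directed system of continuous seminorms that generates $\gamma$. Let $X'_\gamma=(X,\gamma)'$, with the norm $\|\cdot\|_{X'_\gamma}$ given by restricting the norm of the dual Banach space $X'$. Let $A\colon D(A)\subseteq X\to X$ be a linear operator whose domain is $\gamma$-dense in $X$, and let $A'$ be its $\gamma$-dual operator on $X'_\gamma$: $x'\in D(A')$ and $A'x'=y'$ if and only if $x',y'\in X'_\gamma$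 and $\langle Ax,x'\rangle=\langle x,y'\rangle$ for all $x\in D(A)$. Suppose that $A$ is $\Gamma_\gamma$-dissipative, i.e. $p((\lambda-A)x)\ge\lambda p(x)$ for all $\lambda>0$, $x\in D(A)$ and $p\in\Gamma_\gamma$, and that $A'$ is $\|\cdot\|_{X'_\gamma}$-dissipative, i.e. $\|(\lambda-A')x'\|_{X'_\gamma}\ge\lambda\|x'\|_{X'_\gamma}$ for all $\lambda>0$ and $x'\in D(A')$. Then: (a) $A$ is $\gamma$-closable, and its $\gamma$-closure (its smallest $\gamma$-closed extension) is the generator, with respect to $\gamma$, of a $\gamma$-strongly continuous semigroup $(T(t))_{t\ge0}$ of linear operators on $X$ that is $\gamma$-equicontinuous, i.e. for every $p\in\Gamma_\gamma$ there are $\widetilde p\in\Gamma_\gamma$ and $C\ge0$ such that $p(T(t)x)\le C\,\widetilde p(x)$ for all $t\ge0$ and $x\in X$. (b) If $\Gamma_\gamma$ is norming, then $\|T(t)x\|\le\|x\|$ for all $t\ge0$ and $x\in X$. (c) Suppose that $\Gamma_\gamma$ is norming and that $\gamma=\gamma_s$, where, for some norming directed system $\Gamma_\tau$ of continuous seminorms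 generating $\tau$, the submixed topology $\gamma_s$ is the locally convex topology generated by the seminorms $x\mapsto\sup_{n\in\mathbb{N}}a_np_n(x)$ with $p_n\in\Gamma_\tau$, $a_n\ge0$ and $a_n\to0$. Then $(T(t))_{t\ge0}$ is $(\|\cdot\|,\tau)$-equitight: for every directed system $\Gamma$ of continuous seminorms generating $\tau$, every $\varepsilon>0$ and every $p\in\Gamma$ there are $\widetilde p\in\Gamma$ and $C\ge0$ such that $p(T(t)x)\le C\,\widetilde p(x)+\varepsilon\|x\|$ for all $t\ge0$ and $x\in X$. -/

import Mathlib

open Filter Topology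
open scoped NNReal

noncomputable section

/-! ### Systems of seminorms -/

/-- `Γ` is a directed system of continuous seminorms that generates the topology `t`.
Directedness is understood up to constants (`max p q ≤ C r`), which is the most permissive usual
convention and contains the case `C = 1`. -/
structure IsGeneratingSystem {𝕜 X : Type*} [RCLike 𝕜] [AddCommGroup X] [Module 𝕜 X]
    (t : TopologicalSpace X) (Γ : Set (Seminorm 𝕜 X)) : Prop where
  nonempty : Γ.Nonempty
  directed : ∀ p ∈ Γ, ∀ q ∈ Γ, ∃ r ∈ Γ, ∃ C : ℝ≥0, p ≤ C • r ∧ q ≤ C • r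
  generates : WithSeminorms (topology := t) (fun p : Γ => (p : Seminorm 𝕜 X))

/-- `Γ` is norming: `‖x‖ = sup_{p ∈ Γ} p x` for all `x`. -/
def IsNorming {𝕜 X : Type*} [RCLike 𝕜] [NormedAddCommGroup X] [NormedSpace 𝕜 X]
    (Γ : Set (Seminorm 𝕜 X)) : Prop :=
  ∀ x : X, IsLUB ((fun p : Seminorm 𝕜 X => p x) '' Γ) ‖x‖

/-! ### Saks spaces and the mixed topology -/

/-- The topology `τ_{‖·‖}` of a normed space `X`. It is named, as is the norm dual below, so that it
cannot be confused with a second topology `τ` on `X`. -/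
abbrev normTopology (X : Type*) [NormedAddCommGroup X] : TopologicalSpace X :=
  inferInstance

/-- The dual Banach space `X'` of the normed space `X`. -/
abbrev NormDual (𝕜 X : Type*) [RCLike 𝕜] [NormedAddCommGroup X] [NormedSpace 𝕜 X] : Type _ :=
  StrongDual 𝕜 X

/-- The pairing `(x', x) ↦ ⟨x, x'⟩` of `X'` and `X`. -/
def dualPairing (𝕜 X : Type*) [RCLike 𝕜] [NormedAddCommGroup X] [NormedSpace 𝕜 X] :
    NormDual 𝕜 X →ₗ[𝕜] X →ₗ[𝕜] 𝕜 :=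
  ContinuousLinearMap.coeLM 𝕜

@[simp]
theorem dualPairing_apply {𝕜 X : Type*} [RCLike 𝕜] [NormedAddCommGroup X] [NormedSpace 𝕜 X]
    (f : NormDual 𝕜 X) (x : X) : dualPairing 𝕜 X f x = f x :=
  rfl

theorem exists_dualPairing_eq {𝕜 X : Type*} [RCLike 𝕜] [NormedAddCommGroup X] [NormedSpace 𝕜 X]
    (f : X →ₗ[𝕜] 𝕜) (hf : Continuous f) : ∃ g : NormDual 𝕜 X, dualPairing 𝕜 X g = f :=
  ⟨⟨f, hf⟩, rfl⟩

/-- `(X, ‖·‖, τ)` is a Saks space: `X` is a Banach space (`CompleteSpace X`), `τ` is a Hausdorff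
locally convex topology coarser than the norm topology, and there is a norming directed system of
continuous seminorms that generates `τ`. (In Mathlib's order, finer topologies are smaller; that
`τ` is a locally convex vector space topology is part of its being generated by seminorms.) -/
structure IsSaksSpace (𝕜 : Type*) {X : Type*} [RCLike 𝕜] [NormedAddCommGroup X]
    [NormedSpace 𝕜 X] [CompleteSpace X] (τ : TopologicalSpace X) : Prop where
  t2 : @T2Space X τ
  norm_le : normTopology X ≤ τ
  exists_norming : ∃ Γ : Set (Seminorm 𝕜 X), IsGeneratingSystem τ Γ ∧ IsNorming Γ

/-- The topologies among which the mixed topology is the finest one: linear topologies `t` with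
`τ ⊆ t ⊆ τ_{‖·‖}` which induce the same topology as `τ` on every norm-bounded set. -/
def mixedCandidates (𝕜 : Type*) {X : Type*} [RCLike 𝕜] [NormedAddCommGroup X]
    [NormedSpace 𝕜 X] (τ : TopologicalSpace X) : Set (TopologicalSpace X) :=
  {t | @IsTopologicalAddGroup X t _ ∧ @ContinuousSMul 𝕜 X _ _ t ∧
    normTopology X ≤ t ∧ t ≤ τ ∧
    ∀ s : Set X, Bornology.IsBounded s →
      t.induced (Subtype.val : s → X) = τ.induced (Subtype.val : s → X)}

/-- The mixed topology `γ(‖·‖, τ)`: the finest of the candidates, see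
`mixedTopology_isLeast`. -/
def mixedTopology (𝕜 : Type*) {X : Type*} [RCLike 𝕜] [NormedAddCommGroup X]
    [NormedSpace 𝕜 X] (τ : TopologicalSpace X) : TopologicalSpace X :=
  sInf (mixedCandidates 𝕜 τ)

theorem mixedTopology_isTopologicalAddGroup (𝕜 : Type*) {X : Type*} [RCLike 𝕜]
    [NormedAddCommGroup X] [NormedSpace 𝕜 X] (τ : TopologicalSpace X) :
    @IsTopologicalAddGroup X (mixedTopology 𝕜 τ) _ :=
  topologicalAddGroup_sInf fun _ ht => ht.1

theorem norm_le_mixedTopology (𝕜 : Type*) {X : Type*} [RCLike 𝕜]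
    [NormedAddCommGroup X] [NormedSpace 𝕜 X] (τ : TopologicalSpace X) :
    normTopology X ≤ mixedTopology 𝕜 τ :=
  le_sInf fun _ ht => ht.2.2.1

/-- In a Saks space the mixed topology is indeed the finest candidate. -/
theorem mixedTopology_isLeast {𝕜 X : Type*} [RCLike 𝕜]
    [NormedAddCommGroup X] [NormedSpace 𝕜 X] [CompleteSpace X] {τ : TopologicalSpace X}
    (h : IsSaksSpace 𝕜 τ) : IsLeast (mixedCandidates 𝕜 τ) (mixedTopology 𝕜 τ) := by
  have hτ : τ ∈ mixedCandidates 𝕜 τ := by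
    obtain ⟨Γ, hΓ, -⟩ := h.exists_norming
    exact ⟨@WithSeminorms.topologicalAddGroup _ _ _ _ _ _ τ _ hΓ.generates,
      @WithSeminorms.continuousSMul _ _ _ _ _ _ τ _ hΓ.generates, h.norm_le, le_rfl,
      fun _ _ => rfl⟩
  refine ⟨⟨mixedTopology_isTopologicalAddGroup 𝕜 τ, continuousSMul_sInf fun _ ht => ht.2.1,
    norm_le_mixedTopology 𝕜 τ, sInf_le hτ, fun s hs => ?_⟩, fun _ ht => sInf_le ht⟩
  apply le_antisymm (induced_mono (sInf_le hτ))
  have hγ : mixedTopology 𝕜 τ = ⨅ t : mixedCandidates 𝕜 τ, (t : TopologicalSpace X) :=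
    sInf_eq_iInf' _
  change _ ≤ (mixedTopology 𝕜 τ).induced _
  rw [hγ, induced_iInf]
  exact le_iInf fun t => (t.2.2.2.2.2 s hs).ge

/-- The Saks space `(X, ‖·‖, τ)` is complete: `(X, γ)` is complete as a topological vector
space. -/
def IsCompleteSaksSpace (𝕜 : Type*) {X : Type*} [RCLike 𝕜] [NormedAddCommGroup X]
    [NormedSpace 𝕜 X] [CompleteSpace X] (τ : TopologicalSpace X) : Prop :=
  IsSaksSpace 𝕜 τ ∧
    @CompleteSpace X (@IsTopologicalAddGroup.rightUniformSpace X _ (mixedTopology 𝕜 τ)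
      (mixedTopology_isTopologicalAddGroup 𝕜 τ))

/-! ### The submixed topology -/

/-- The index set `𝒩` of the seminorms that generate the submixed topology: sequences in `Γ` with
nonnegative real null sequences of weights. -/
def SubmixedIndex {𝕜 X : Type*} [RCLike 𝕜] [AddCommGroup X] [Module 𝕜 X]
    (Γ : Set (Seminorm 𝕜 X)) : Type _ :=
  {pa : (ℕ → Seminorm 𝕜 X) × (ℕ → ℝ≥0) // (∀ n, pa.1 n ∈ Γ) ∧ Tendsto pa.2 atTop (𝓝 0)}

/-- The seminorm `x ↦ sup_n a_n p_n(x)`; see `submixedSeminorm_apply`. -/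
def submixedSeminorm {𝕜 X : Type*} [RCLike 𝕜] [AddCommGroup X] [Module 𝕜 X]
    (Γ : Set (Seminorm 𝕜 X)) (i : SubmixedIndex Γ) : Seminorm 𝕜 X :=
  ⨆ n, i.1.2 n • i.1.1 n

theorem submixedSeminorm_apply {𝕜 X : Type*} [RCLike 𝕜] [NormedAddCommGroup X]
    [NormedSpace 𝕜 X] {Γ : Set (Seminorm 𝕜 X)} (hΓ : IsNorming Γ) (i : SubmixedIndex Γ) (x : X) :
    submixedSeminorm Γ i x = ⨆ n, (i.1.2 n : ℝ) * i.1.1 n x ∧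
      BddAbove (Set.range fun n => (i.1.2 n : ℝ) * i.1.1 n x) := by
  obtain ⟨C, hC⟩ := i.2.2.bddAbove_range
  have key : ∀ n y, (i.1.2 n : ℝ) * i.1.1 n y ≤ C * ‖y‖ := fun n y =>
    mul_le_mul (NNReal.coe_le_coe.2 (hC ⟨n, rfl⟩)) ((hΓ y).1 ⟨_, i.2.1 n, rfl⟩)
      (apply_nonneg _ _) C.2
  refine ⟨?_, ⟨C * ‖x‖, by rintro _ ⟨n, rfl⟩; exact key n x⟩⟩
  rw [submixedSeminorm, Seminorm.iSup_apply]
  · rfl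
  · refine ⟨C • normSeminorm 𝕜 X, ?_⟩
    rintro _ ⟨n, rfl⟩ y
    exact key n y

/-- The submixed topology `γ_s`, built from the (norming) generating system `Γ` of `τ`. -/
def submixedTopology {𝕜 X : Type*} [RCLike 𝕜] [AddCommGroup X] [Module 𝕜 X]
    (Γ : Set (Seminorm 𝕜 X)) : TopologicalSpace X :=
  (SeminormFamily.moduleFilterBasis (𝕜 := 𝕜) (F := X) (submixedSeminorm Γ)).topology

/-! ### Linear operators, closures, duals, dissipativity -/

/-- The operator `A` is `t`-closed: its graph is closed for the product topology, i.e. limits of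
nets in the graph belong to the graph. -/
def IsClosedOperator {𝕜 X : Type*} [RCLike 𝕜] [AddCommGroup X] [Module 𝕜 X]
    (t : TopologicalSpace X) (A : X →ₗ.[𝕜] X) : Prop :=
  @IsClosed (X × X) (@instTopologicalSpaceProd X X t t) (A.graph : Set (X × X))

/-- `B` is the `t`-closure of `A`: the smallest `t`-closed extension of `A` (the order on
`X →ₗ.[𝕜] X` is extension of operators). In particular, `A` is `t`-closable. -/
def IsClosureOf {𝕜 X : Type*} [RCLike 𝕜] [AddCommGroup X] [Module 𝕜 X]
    (t : TopologicalSpace X) (A B : X →ₗ.[𝕜] X) : Prop :=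
  IsLeast {C : X →ₗ.[𝕜] X | A ≤ C ∧ IsClosedOperator t C} B

/-- `A` is `Γ`-dissipative: `p ((lam - A) x) ≥ lam * p x` for `lam > 0`, `x ∈ D(A)`, `p ∈ Γ`. -/
def IsDissipative {𝕜 E : Type*} [RCLike 𝕜] [AddCommGroup E] [Module 𝕜 E]
    (Γ : Set (Seminorm 𝕜 E)) (A : E →ₗ.[𝕜] E) : Prop :=
  ∀ lam : ℝ, 0 < lam → ∀ x : A.domain, ∀ p ∈ Γ,
    lam * p (x : E) ≤ p ((lam : 𝕜) • (x : E) - A x)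

/-- `A` is `‖·‖`-dissipative on a normed space: dissipativity for the single seminorm `‖·‖`. -/
def IsNormDissipative {𝕜 E : Type*} [RCLike 𝕜] [NormedAddCommGroup E] [NormedSpace 𝕜 E]
    (A : E →ₗ.[𝕜] E) : Prop :=
  IsDissipative {normSeminorm 𝕜 E} A

/-- The dual `X'_γ = (X, γ)'` as a subspace of the norm dual `X'`, with the restriction of the dual
norm. Nothing is lost, since `γ`-continuous functionals are norm continuous, see
`exists_mem_mixedDual`. -/
def mixedDual (𝕜 : Type*) {X : Type*} [RCLike 𝕜] [NormedAddCommGroup X] [NormedSpace 𝕜 X]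
    (τ : TopologicalSpace X) : Submodule 𝕜 (NormDual 𝕜 X) where
  carrier := {f | @Continuous X 𝕜 (mixedTopology 𝕜 τ) _ (dualPairing 𝕜 X f)}
  zero_mem' := by
    change @Continuous X 𝕜 (mixedTopology 𝕜 τ) _ fun _ => 0
    exact @continuous_const X 𝕜 (mixedTopology 𝕜 τ) _ 0
  add_mem' := fun hf hg => by
    rw [Set.mem_ofPred_eq, _root_.map_add]
    exact @Continuous.add 𝕜 _ _ _ X (mixedTopology 𝕜 τ) _ _ hf hg
  smul_mem' := fun c f hf => by
    rw [Set.mem_ofPred_eq, _root_.map_smul]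
    exact @Continuous.const_smul 𝕜 𝕜 X _ _ _ (mixedTopology 𝕜 τ) _ hf c

theorem exists_mem_mixedDual {𝕜 X : Type*} [RCLike 𝕜] [NormedAddCommGroup X] [NormedSpace 𝕜 X]
    (τ : TopologicalSpace X) (f : X →ₗ[𝕜] 𝕜) (hf : @Continuous X 𝕜 (mixedTopology 𝕜 τ) _ f) :
    ∃ g ∈ mixedDual 𝕜 τ, dualPairing 𝕜 X g = f := by
  obtain ⟨g, hg⟩ := exists_dualPairing_eq f (continuous_le_dom (norm_le_mixedTopology 𝕜 τ) hf)
  refine ⟨g, ?_, hg⟩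
  change @Continuous X 𝕜 (mixedTopology 𝕜 τ) _ (dualPairing 𝕜 X g)
  rwa [hg]

/-- The graph of the `γ`-dual operator: the pairs `(x', y')` in `X'_γ × X'_γ` with
`⟨A x, x'⟩ = ⟨x, y'⟩` for all `x ∈ D(A)`. -/
def mixedDualGraph {𝕜 X : Type*} [RCLike 𝕜] [NormedAddCommGroup X] [NormedSpace 𝕜 X]
    (τ : TopologicalSpace X) (A : X →ₗ.[𝕜] X) :
    Submodule 𝕜 (mixedDual 𝕜 τ × mixedDual 𝕜 τ) where
  carrier := {z | ∀ x : A.domain, dualPairing 𝕜 X z.1 (A x) = dualPairing 𝕜 X z.2 x}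
  zero_mem' := fun _ => rfl
  add_mem' := fun {z w} hz hw x => by
    change dualPairing 𝕜 X z.1 (A x) + dualPairing 𝕜 X w.1 (A x) =
      dualPairing 𝕜 X z.2 x + dualPairing 𝕜 X w.2 x
    rw [hz x, hw x]
  smul_mem' := fun c z hz x => by
    change c • dualPairing 𝕜 X z.1 (A x) = c • dualPairing 𝕜 X z.2 x
    rw [hz x]

/-- The `γ`-dual operator `(A', D(A'))` of a `γ`-densely defined operator `A`; see
`mem_graph_mixedDualOperator`. -/
def mixedDualOperator {𝕜 X : Type*} [RCLike 𝕜] [NormedAddCommGroup X] [NormedSpace 𝕜 X]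
    (τ : TopologicalSpace X) (A : X →ₗ.[𝕜] X) : mixedDual 𝕜 τ →ₗ.[𝕜] mixedDual 𝕜 τ :=
  (mixedDualGraph τ A).toLinearPMap

/-- `A` is `t`-densely defined. -/
def IsDenselyDefined {𝕜 X : Type*} [RCLike 𝕜] [AddCommGroup X] [Module 𝕜 X]
    (t : TopologicalSpace X) (A : X →ₗ.[𝕜] X) : Prop :=
  @Dense X t (A.domain : Set X)

theorem mem_graph_mixedDualOperator {𝕜 X : Type*} [RCLike 𝕜] [NormedAddCommGroup X]
    [NormedSpace 𝕜 X] (τ : TopologicalSpace X) (A : X →ₗ.[𝕜] X)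
    (hA : IsDenselyDefined (mixedTopology 𝕜 τ) A) (x' y' : mixedDual 𝕜 τ) :
    (x', y') ∈ (mixedDualOperator τ A).graph ↔
      ∀ x : A.domain, dualPairing 𝕜 X x' (A x) = dualPairing 𝕜 X y' x := by
  rw [mixedDualOperator, Submodule.toLinearPMap_graph_eq]
  · rfl
  · rintro ⟨u, v⟩ huv hu
    obtain rfl : u = 0 := hu
    have h0 : (dualPairing 𝕜 X v : X → 𝕜) = fun _ => 0 :=
      @Continuous.ext_on 𝕜 X _ (mixedTopology 𝕜 τ) _ _ hA _ _ v.2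
        (@continuous_const X 𝕜 (mixedTopology 𝕜 τ) _ 0) fun x hx => (huv ⟨x, hx⟩).symm
    exact Subtype.ext (DFunLike.ext _ _ fun x => congrFun h0 x)

/-! ### Semigroups -/

/-- `(T(s))_{s ≥ 0}` is a `t`-strongly continuous semigroup of linear operators on `X`. -/
structure IsStronglyContinuousSemigroup {𝕜 X : Type*} [RCLike 𝕜] [AddCommGroup X] [Module 𝕜 X]
    (t : TopologicalSpace X) (T : ℝ≥0 → X →ₗ[𝕜] X) : Prop where
  map_zero : T 0 = LinearMap.id
  map_add : ∀ s u : ℝ≥0, T (s + u) = T s ∘ₗ T u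
  continuous_orbit : ∀ x : X, @Continuous ℝ≥0 X _ t fun s => T s x

/-- `B` is the generator of `(T(s))_{s ≥ 0}` for the topology `t`: `x ∈ D(B)` and `B x = y` iff
`(T(s) x - x) / s → y` in `t` as `s → 0+`. -/
def IsGenerator {𝕜 X : Type*} [RCLike 𝕜] [AddCommGroup X] [Module 𝕜 X]
    (t : TopologicalSpace X) (T : ℝ≥0 → X →ₗ[𝕜] X) (B : X →ₗ.[𝕜] X) : Prop :=
  ∀ x y : X, (x, y) ∈ B.graph ↔
    Tendsto (fun s : ℝ≥0 => ((s : ℝ) : 𝕜)⁻¹ • (T s x - x)) (𝓝[>] 0) (@nhds X t y)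

/-- Equicontinuity of a family of linear maps, for the topology generated by `Γ`. -/
def IsEquicontinuousFamily {𝕜 X I : Type*} [RCLike 𝕜] [AddCommGroup X] [Module 𝕜 X]
    (Γ : Set (Seminorm 𝕜 X)) (T : I → X →ₗ[𝕜] X) : Prop :=
  ∀ p ∈ Γ, ∃ q ∈ Γ, ∃ C : ℝ≥0, ∀ (i : I) (x : X), p (T i x) ≤ C * q x

/-- `(‖·‖, τ)`-equitightness of a family of linear maps, for `τ` generated by `Γ`. -/
def IsEquitightFamily {𝕜 X I : Type*} [RCLike 𝕜] [NormedAddCommGroup X] [NormedSpace 𝕜 X]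
    (Γ : Set (Seminorm 𝕜 X)) (T : I → X →ₗ[𝕜] X) : Prop :=
  ∀ ε : ℝ, 0 < ε → ∀ p ∈ Γ, ∃ q ∈ Γ, ∃ C : ℝ≥0, ∀ (i : I) (x : X),
    p (T i x) ≤ C * q x + ε * ‖x‖

/-- The operators of the family are contractions of the normed space `X`. -/
def IsContractive {𝕜 X I : Type*} [RCLike 𝕜] [NormedAddCommGroup X] [NormedSpace 𝕜 X]
    (T : I → X →ₗ[𝕜] X) : Prop :=
  ∀ (i : I) (x : X), ‖T i x‖ ≤ ‖x‖

end

/-! This is the Lumer–Phillips theorem in the complete locally convex space `(X, γ)`, followed by a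
comparison of seminorms.

Range: a `γ`-continuous functional `f` vanishing on the range of `lam - A` satisfies `A' f = lam f`,
so norm dissipativity of `A'` forces `f = 0`. By Hahn–Banach the range is `γ`-dense
(`dense_range_of_isNormDissipative`). Dissipativity of `A` makes `(lam - A)⁻¹` continuous on that
range; completeness extends it to all of `X`, with values in the domain of the closed graph
(`IsDissipativeRelation.exists_resolvent`). Density of the domain makes the closed graph
single-valued (`IsDissipativeRelation.eq_zero`).

Semigroup: each `V s = (1 - s G)⁻¹` is a contraction for every seminorm of the system, and `T t` is
the limit of the implicit Euler scheme `V (2⁻ⁿ) ^ ⌊t 2ⁿ⌋`. Only powers of contractions occur, so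
each seminorm is treated separately. Halving the step changes the scheme by `O(2⁻ⁿ)` on the domain
of `G²`, which is dense; contractivity carries convergence to all of `X`
(`IsResolventFamily.exists_semigroup_generator`).

Consequences: each `p ∈ Γγ` is contracted by every `T t`. Taking the supremum over a norming `Γγ`
gives (b). For (c), a seminorm continuous for the submixed topology is dominated by a `τ`-continuous
one up to `ε ‖·‖`, because the tail of a null sequence of weights is small; contractivity moves `T
t` out of the estimate first. -/

/-! ### Resolvents of a linear relation -/

section Resolvent

variable {𝕜 X : Type*} [RCLike 𝕜] [AddCommGroup X] [Module 𝕜 X]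

/-- `V s = (1 - s G)⁻¹` for all `s > 0`, where the operator `G` is given by its graph. -/
structure IsResolventFamily (G : Submodule 𝕜 (X × X)) (V : ℝ → Module.End 𝕜 X) : Prop where
  mem : ∀ s : ℝ, 0 < s → ∀ y, (V s y, (s : 𝕜)⁻¹ • (V s y - y)) ∈ G
  left_inv : ∀ s : ℝ, 0 < s → ∀ x y, (x, y) ∈ G → V s (x - (s : 𝕜) • y) = x

/-- The implicit Euler approximation with step `2⁻ⁿ` at time `t`. -/
noncomputable def eulerApprox (V : ℝ → Module.End 𝕜 X) (n : ℕ) (t : ℝ≥0) : Module.End 𝕜 X :=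
  V ((2 : ℝ)⁻¹ ^ n) ^ ⌊(t : ℝ) * 2 ^ n⌋₊

theorem Seminorm.pow_apply_le {q : Seminorm 𝕜 X} {W : Module.End 𝕜 X} (hW : ∀ y, q (W y) ≤ q y)
    (k : ℕ) (y : X) : q ((W ^ k) y) ≤ q y := by
  induction k with
  | zero => simp
  | succ k ih =>
    rw [pow_succ', Module.End.mul_apply]
    exact (hW _).trans ih

theorem Seminorm.pow_apply_sub_le {q : Seminorm 𝕜 X} {W : Module.End 𝕜 X}
    (hW : ∀ y, q (W y) ≤ q y) (k : ℕ) (y : X) : q ((W ^ k) y - y) ≤ k * q (W y - y) := by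
  induction k with
  | zero => simp
  | succ k ih =>
    have h : (W ^ (k + 1)) y - y = (W ^ k) (W y - y) + ((W ^ k) y - y) := by
      rw [pow_succ, Module.End.mul_apply, map_sub]; abel
    rw [h]
    refine (map_add_le_add q _ _).trans ?_
    have := Seminorm.pow_apply_le hW k (W y - y)
    push_cast
    linarith

theorem Seminorm.pow_apply_sub_pow_apply_le {q : Seminorm 𝕜 X} {W : Module.End 𝕜 X}
    (hW : ∀ y, q (W y) ≤ q y) {j k m : ℕ} (h₁ : k ≤ j + m) (h₂ : j ≤ k + m) (y : X) :
    q ((W ^ k) y - (W ^ j) y) ≤ m * q (W y - y) := by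
  wlog hjk : j ≤ k generalizing j k
  · rw [map_sub_rev]
    exact this h₂ h₁ (le_of_not_ge hjk)
  obtain ⟨l, rfl⟩ := Nat.exists_eq_add_of_le hjk
  rw [pow_add, Module.End.mul_apply, ← map_sub]
  refine (Seminorm.pow_apply_le hW _ _).trans ((Seminorm.pow_apply_sub_le hW _ _).trans ?_)
  have : (l : ℝ) ≤ m := by exact_mod_cast (by omega : l ≤ m)
  exact mul_le_mul_of_nonneg_right this (apply_nonneg _ _)

/-- Telescoping of `W ^ k - U ^ k`: commutation lets `W - U` act directly on `x`, and the remaining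
factors are contractions. -/
theorem Seminorm.pow_apply_sub_pow_apply_le_of_commute {q : Seminorm 𝕜 X} {W U : Module.End 𝕜 X}
    (hW : ∀ y, q (W y) ≤ q y) (hU : ∀ y, q (U y) ≤ q y) (hWU : Commute W U) (k : ℕ) (x : X) :
    q ((W ^ k) x - (U ^ k) x) ≤ k * q (W x - U x) := by
  induction k with
  | zero => simp
  | succ k ih =>
    have h : (W ^ (k + 1)) x - (U ^ (k + 1)) x =
        (W ^ k) (W x - U x) + U ((W ^ k) x - (U ^ k) x) := by
      have : U ((W ^ k) x) = (W ^ k) (U x) := by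
        rw [← Module.End.mul_apply, ← Module.End.mul_apply, (hWU.pow_left k).eq]
      rw [pow_succ, pow_succ', Module.End.mul_apply, Module.End.mul_apply, map_sub, map_sub, this]
      abel
    rw [h]
    refine (map_add_le_add q _ _).trans ?_
    have := Seminorm.pow_apply_le hW k (W x - U x)
    have := hU ((W ^ k) x - (U ^ k) x)
    push_cast
    linarith

namespace IsResolventFamily

variable {G : Submodule 𝕜 (X × X)} {V : ℝ → Module.End 𝕜 X} {q : Seminorm 𝕜 X}

theorem apply_sub (hV : IsResolventFamily G V) {s : ℝ} (hs : 0 < s) {x y : X} (h : (x, y) ∈ G) :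
    V s x - x = (s : 𝕜) • V s y := by
  have := hV.left_inv s hs x y h
  rw [map_sub, map_smul] at this
  rw [sub_eq_iff_eq_add, ← sub_eq_iff_eq_add', this]

theorem map_mem (hV : IsResolventFamily G V) {s : ℝ} (hs : 0 < s) {x y : X} (h : (x, y) ∈ G) :
    (V s x, V s y) ∈ G := by
  have hs' : (s : 𝕜) ≠ 0 := RCLike.ofReal_ne_zero.2 hs.ne'
  have := hV.mem s hs x
  rwa [hV.apply_sub hs h, inv_smul_smul₀ hs'] at this

theorem commute (hV : IsResolventFamily G V) {r s : ℝ} (hr : 0 < r) (hs : 0 < s) :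
    Commute (V r) (V s) := by
  have hr' : (r : 𝕜) ≠ 0 := RCLike.ofReal_ne_zero.2 hr.ne'
  refine LinearMap.ext fun x => ?_
  have h := hV.left_inv r hr _ _ (hV.map_mem hs (hV.mem r hr x))
  rw [map_smul, smul_inv_smul₀ hr', ← map_sub, sub_sub_cancel] at h
  exact h

theorem seminorm_apply_sub_le (hV : IsResolventFamily G V) {s : ℝ} (hs : 0 < s)
    (hq : ∀ y, q (V s y) ≤ q y) {x y : X} (h : (x, y) ∈ G) : q (V s x - x) ≤ s * q y := by
  rw [hV.apply_sub hs h, map_smul_eq_mul, RCLike.norm_ofReal, abs_of_pos hs]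
  exact mul_le_mul_of_nonneg_left (hq y) hs.le

/-- One Euler step of length `2r` and two of length `r` agree to first order, the difference being
`r (2 V (2r) y - V r ^ 2 y - V r y)`. Since `y` is again in the domain, each of these terms is `y +
O(r)`, so the local error is quadratic. -/
theorem seminorm_sub_sq_le (hV : IsResolventFamily G V) (hq : ∀ s, 0 < s → ∀ y, q (V s y) ≤ q y)
    {r : ℝ} (hr : 0 < r) {x y w : X} (hxy : (x, y) ∈ G) (hyw : (y, w) ∈ G) :
    q (V (2 * r) x - (V r ^ 2) x) ≤ 7 * r ^ 2 * q w := by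
  have hr2 : 0 < 2 * r := by positivity
  have h1 := hV.apply_sub hr2 hxy
  have h2 := hV.apply_sub hr hxy
  have h3 : V r (V r x) - V r x = (r : 𝕜) • V r (V r y) := by rw [← map_sub, h2, map_smul]
  have e : V (2 * r) x - (V r ^ 2) x =
      (r : 𝕜) • (((V (2 * r) y - y) - ((V r ^ 2) y - y)) + ((V (2 * r) y - y) - (V r y - y))) := by
    have : V (2 * r) x - (V r ^ 2) x = (V (2 * r) x - x) - (V r (V r x) - V r x) - (V r x - x) := by
      rw [pow_two, Module.End.mul_apply]; abel
    rw [this, h1, h2, h3, pow_two, Module.End.mul_apply]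
    push_cast
    module
  rw [e, map_smul_eq_mul, RCLike.norm_ofReal, abs_of_pos hr]
  have b1 := hV.seminorm_apply_sub_le hr2 (hq _ hr2) hyw
  have b2 := hV.seminorm_apply_sub_le hr (hq _ hr) hyw
  have b3 := Seminorm.pow_apply_sub_le (hq r hr) 2 y
  have c1 := map_add_le_add q ((V (2 * r) y - y) - ((V r ^ 2) y - y))
    ((V (2 * r) y - y) - (V r y - y))
  have c2 := map_sub_le_add q (V (2 * r) y - y) ((V r ^ 2) y - y)
  have c3 := map_sub_le_add q (V (2 * r) y - y) (V r y - y)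
  push_cast at b3
  -- The constant is `7 = 2 + 2 + 2 + 1`: the bound `2r` for `V (2r)` twice, `2r` for `V r ^ 2`, and
  -- `r` for `V r`.
  calc r * _ ≤ r * (7 * r * q w) := mul_le_mul_of_nonneg_left (by linarith) hr.le
    _ = _ := by ring

end IsResolventFamily

/-! ### Error estimates for the implicit Euler scheme -/

section Euler

variable {G : Submodule 𝕜 (X × X)} {V : ℝ → Module.End 𝕜 X} {q : Seminorm 𝕜 X}

theorem two_inv_pow_pos (n : ℕ) : (0 : ℝ) < (2 : ℝ)⁻¹ ^ n := by positivity

theorem seminorm_eulerApprox_le (hq : ∀ s, 0 < s → ∀ y, q (V s y) ≤ q y) (n : ℕ) (t : ℝ≥0)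
    (x : X) : q (eulerApprox V n t x) ≤ q x :=
  Seminorm.pow_apply_le (hq _ (two_inv_pow_pos n)) _ _

theorem floor_mul_two_inv_pow_le (n : ℕ) (t : ℝ≥0) :
    (⌊(t : ℝ) * 2 ^ n⌋₊ : ℝ) * 2⁻¹ ^ n ≤ t := by
  have h := Nat.floor_le (a := (t : ℝ) * 2 ^ n) (by positivity)
  calc _ ≤ (t : ℝ) * 2 ^ n * 2⁻¹ ^ n := mul_le_mul_of_nonneg_right h (two_inv_pow_pos n).le
    _ = t := by rw [mul_assoc, ← mul_pow]; norm_num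

theorem le_floor_mul_two_inv_pow (n : ℕ) (t : ℝ≥0) :
    (t : ℝ) ≤ (⌊(t : ℝ) * 2 ^ n⌋₊ : ℝ) * 2⁻¹ ^ n + 2⁻¹ ^ n := by
  have h := (Nat.lt_floor_add_one ((t : ℝ) * 2 ^ n)).le
  calc (t : ℝ) = (t : ℝ) * 2 ^ n * 2⁻¹ ^ n := by rw [mul_assoc, ← mul_pow]; norm_num
    _ ≤ ((⌊(t : ℝ) * 2 ^ n⌋₊ : ℝ) + 1) * 2⁻¹ ^ n :=
      mul_le_mul_of_nonneg_right h (two_inv_pow_pos n).le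
    _ = _ := by ring

/-- With `r` the halved step, the number of steps becomes `2k` or `2k + 1`. A possible extra step
costs `r q y`, and replacing each of the `k` steps `V (2r)` by `V r ^ 2` costs `7 r² q w`, where
`2kr ≤ t`. The factor `r` is written as a difference of consecutive powers so that the bounds
telescope in `n`. -/
theorem seminorm_eulerApprox_succ_sub_le (hV : IsResolventFamily G V)
    (hq : ∀ s, 0 < s → ∀ y, q (V s y) ≤ q y) (n : ℕ) (t : ℝ≥0) {x y w : X}
    (hxy : (x, y) ∈ G) (hyw : (y, w) ∈ G) :
    q (eulerApprox V (n + 1) t x - eulerApprox V n t x) ≤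
      (q y + 7 * t * q w) * (2⁻¹ ^ n - 2⁻¹ ^ (n + 1)) := by
  set r : ℝ := (2 : ℝ)⁻¹ ^ (n + 1) with hr
  have hr0 : 0 < r := two_inv_pow_pos _
  have h2r : (2 : ℝ)⁻¹ ^ n = 2 * r := by rw [hr, pow_succ]; ring
  set k := ⌊(t : ℝ) * 2 ^ n⌋₊ with hk
  set k' := ⌊(t : ℝ) * 2 ^ (n + 1)⌋₊ with hk'
  have hkr : (k : ℝ) * (2 * r) ≤ t := by rw [← h2r]; exact floor_mul_two_inv_pow_le n t
  have ht0 : (0 : ℝ) ≤ t * 2 ^ n := by positivity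
  have f1 := Nat.floor_le ht0
  have f2 := Nat.lt_floor_add_one ((t : ℝ) * 2 ^ n)
  have e2 : (t : ℝ) * 2 ^ (n + 1) = 2 * (t * 2 ^ n) := by ring
  have g1 : 2 * k ≤ k' := Nat.le_floor (by rw [e2]; push_cast; linarith)
  have g2 : k' ≤ 2 * k + 1 := by
    refine Nat.lt_succ_iff.1 ((Nat.floor_lt (by positivity)).2 ?_)
    rw [e2]; push_cast; linarith
  have a1 : q ((V r ^ k') x - (V r ^ (2 * k)) x) ≤ r * q y := by
    refine (Seminorm.pow_apply_sub_pow_apply_le (m := 1) (hq r hr0) g2 (by omega) x).trans ?_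
    rw [Nat.cast_one, one_mul]
    exact hV.seminorm_apply_sub_le hr0 (hq r hr0) hxy
  have a2 : q ((V r ^ (2 * k)) x - (V (2 * r) ^ k) x) ≤ k * (7 * r ^ 2 * q w) := by
    rw [map_sub_rev, pow_mul]
    refine (Seminorm.pow_apply_sub_pow_apply_le_of_commute (hq _ (by positivity))
      (Seminorm.pow_apply_le (hq r hr0) 2)
      ((hV.commute (by positivity) hr0).pow_right 2) k x).trans ?_
    exact mul_le_mul_of_nonneg_left (hV.seminorm_sub_sq_le hq hr0 hxy hyw) (Nat.cast_nonneg k)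
  have e : eulerApprox V (n + 1) t x - eulerApprox V n t x =
      ((V r ^ k') x - (V r ^ (2 * k)) x) + ((V r ^ (2 * k)) x - (V (2 * r) ^ k) x) := by
    rw [eulerApprox, eulerApprox, h2r]; abel
  rw [e, h2r]
  refine (map_add_le_add q _ _).trans ?_
  have : (k : ℝ) * (7 * r ^ 2 * q w) ≤ 7 * t * q w * r := by
    calc _ = (k * (2 * r)) * (7 / 2 * r * q w) := by ring
      _ ≤ t * (7 / 2 * r * q w) := mul_le_mul_of_nonneg_right hkr (by positivity)
      _ ≤ t * (7 * r * q w) := by gcongr; norm_num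
      _ = _ := by ring
  linarith

theorem seminorm_eulerApprox_add_sub_le (hV : IsResolventFamily G V)
    (hq : ∀ s, 0 < s → ∀ y, q (V s y) ≤ q y) (n j : ℕ) (t : ℝ≥0) {x y w : X}
    (hxy : (x, y) ∈ G) (hyw : (y, w) ∈ G) :
    q (eulerApprox V (n + j) t x - eulerApprox V n t x) ≤
      (q y + 7 * t * q w) * (2⁻¹ ^ n - 2⁻¹ ^ (n + j)) := by
  induction j with
  | zero => simp
  | succ j ih =>
    have h := seminorm_eulerApprox_succ_sub_le hV hq (n + j) t hxy hyw
    have := map_add_le_add q (eulerApprox V (n + j + 1) t x - eulerApprox V (n + j) t x)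
      (eulerApprox V (n + j) t x - eulerApprox V n t x)
    rw [sub_add_sub_cancel] at this
    rw [← add_assoc]
    linarith

/-- The integer part is additive up to one, so the semigroup law fails by at most one Euler step. -/
theorem seminorm_eulerApprox_comp_sub_le (hV : IsResolventFamily G V)
    (hq : ∀ s, 0 < s → ∀ y, q (V s y) ≤ q y) (n : ℕ) (t u : ℝ≥0) {x y : X} (hxy : (x, y) ∈ G) :
    q (eulerApprox V n (t + u) x - eulerApprox V n t (eulerApprox V n u x)) ≤ 2⁻¹ ^ n * q y := by
  rw [eulerApprox, eulerApprox, eulerApprox, ← Module.End.mul_apply, ← pow_add]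
  have ht0 : (0 : ℝ) ≤ t * 2 ^ n := by positivity
  have hu0 : (0 : ℝ) ≤ u * 2 ^ n := by positivity
  have f1 := Nat.floor_le ht0
  have f2 := Nat.lt_floor_add_one ((t : ℝ) * 2 ^ n)
  have f3 := Nat.floor_le hu0
  have f4 := Nat.lt_floor_add_one ((u : ℝ) * 2 ^ n)
  have e : ((t + u : ℝ≥0) : ℝ) * 2 ^ n = t * 2 ^ n + u * 2 ^ n := by push_cast; ring
  rw [e]
  have g1 : ⌊(t : ℝ) * 2 ^ n⌋₊ + ⌊(u : ℝ) * 2 ^ n⌋₊ ≤ ⌊(t : ℝ) * 2 ^ n + u * 2 ^ n⌋₊ :=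
    Nat.le_floor (by push_cast; linarith)
  have g2 : ⌊(t : ℝ) * 2 ^ n + u * 2 ^ n⌋₊ ≤ ⌊(t : ℝ) * 2 ^ n⌋₊ + ⌊(u : ℝ) * 2 ^ n⌋₊ + 1 := by
    refine Nat.lt_succ_iff.1 ((Nat.floor_lt (by positivity)).2 ?_)
    push_cast; linarith
  have hn := two_inv_pow_pos n
  refine (Seminorm.pow_apply_sub_pow_apply_le (m := 1) (hq _ hn) g2 (by omega) x).trans ?_
  rw [Nat.cast_one, one_mul]
  exact hV.seminorm_apply_sub_le hn (hq _ hn) hxy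

theorem seminorm_eulerApprox_sub_self_le (hV : IsResolventFamily G V)
    (hq : ∀ s, 0 < s → ∀ y, q (V s y) ≤ q y) (n : ℕ) (t : ℝ≥0) {x y : X} (hxy : (x, y) ∈ G) :
    q (eulerApprox V n t x - x) ≤ t * q y := by
  have hn := two_inv_pow_pos n
  refine (Seminorm.pow_apply_sub_le (hq _ hn) _ x).trans ?_
  calc _ ≤ (⌊(t : ℝ) * 2 ^ n⌋₊ : ℝ) * (2⁻¹ ^ n * q y) :=
      mul_le_mul_of_nonneg_left (hV.seminorm_apply_sub_le hn (hq _ hn) hxy) (Nat.cast_nonneg _)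
    _ = (⌊(t : ℝ) * 2 ^ n⌋₊ * 2⁻¹ ^ n) * q y := by ring
    _ ≤ _ := mul_le_mul_of_nonneg_right (floor_mul_two_inv_pow_le n t) (apply_nonneg _ _)

/-- First-order Taylor estimate: the remainder is the sum of the terms `s (V s ^ j y - y)` for `1 ≤
j ≤ k`. As `y` need not lie in the domain, it is replaced by a domain element `z`, at the cost `2 q
(y - z)`. -/
theorem seminorm_pow_sub_sub_smul_le (hV : IsResolventFamily G V)
    {s : ℝ} (hs : 0 < s) (hq : ∀ y, q (V s y) ≤ q y) {x y z w : X} (hxy : (x, y) ∈ G)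
    (hzw : (z, w) ∈ G) (k : ℕ) :
    q ((V s ^ k) x - x - ((k * s : ℝ) : 𝕜) • y) ≤
      k * s * (2 * q (y - z) + k * s * q w) := by
  have key : ∀ j : ℕ, q ((V s ^ j) y - y) ≤ 2 * q (y - z) + j * s * q w := fun j => by
    have e : (V s ^ j) y - y = (V s ^ j) (y - z) - (y - z) + ((V s ^ j) z - z) := by
      rw [map_sub]; abel
    have h1 := Seminorm.pow_apply_le hq j (y - z)
    have h2 := Seminorm.pow_apply_sub_le hq j z
    have h3 := mul_le_mul_of_nonneg_left (hV.seminorm_apply_sub_le hs hq hzw) (Nat.cast_nonneg j)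
    have h4 := map_add_le_add q ((V s ^ j) (y - z) - (y - z)) ((V s ^ j) z - z)
    have h5 := map_sub_le_add q ((V s ^ j) (y - z)) (y - z)
    rw [e]
    linarith
  induction k with
  | zero => simp
  | succ k ih =>
    have e : (V s ^ (k + 1)) x - x - (((k + 1 : ℕ) * s : ℝ) : 𝕜) • y =
        ((V s ^ k) x - x - ((k * s : ℝ) : 𝕜) • y) + (s : 𝕜) • ((V s ^ (k + 1)) y - y) := by
      have h : (V s ^ (k + 1)) x - (V s ^ k) x = (s : 𝕜) • (V s ^ (k + 1)) y := by
        rw [pow_succ, Module.End.mul_apply, Module.End.mul_apply, ← map_sub,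
          hV.apply_sub hs hxy, map_smul]
      rw [smul_sub, ← h]
      push_cast
      module
    rw [e]
    refine (map_add_le_add q _ _).trans ?_
    rw [map_smul_eq_mul q, RCLike.norm_ofReal, abs_of_pos hs]
    have h1 := mul_le_mul_of_nonneg_left (key (k + 1)) hs.le
    have h2 : 0 ≤ k * s * (s * q w) := by positivity
    push_cast at h1 ih ⊢
    linarith

theorem seminorm_eulerApprox_sub_sub_smul_le (hV : IsResolventFamily G V)
    (hq : ∀ s, 0 < s → ∀ y, q (V s y) ≤ q y) (n : ℕ) (t : ℝ≥0) {x y z w : X}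
    (hxy : (x, y) ∈ G) (hzw : (z, w) ∈ G) :
    q (eulerApprox V n t x - x - ((t : ℝ) : 𝕜) • y) ≤
      t * (2 * q (y - z) + t * q w) + 2⁻¹ ^ n * q y := by
  have hn := two_inv_pow_pos n
  set a : ℝ := ⌊(t : ℝ) * 2 ^ n⌋₊ * 2⁻¹ ^ n with ha
  have h0 : 0 ≤ a := by positivity
  have h1 := floor_mul_two_inv_pow_le n t
  have h2 := le_floor_mul_two_inv_pow n t
  have h3 := seminorm_pow_sub_sub_smul_le hV hn (hq _ hn) hxy hzw ⌊(t : ℝ) * 2 ^ n⌋₊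
  rw [← ha] at h1 h2 h3
  have e : eulerApprox V n t x - x - ((t : ℝ) : 𝕜) • y =
      (eulerApprox V n t x - x - (a : 𝕜) • y) - ((t - a : ℝ) : 𝕜) • y := by
    push_cast; module
  rw [e]
  refine (map_sub_le_add q _ _).trans (add_le_add (h3.trans ?_) ?_)
  · have := apply_nonneg q (y - z)
    have := apply_nonneg q w
    gcongr
  · rw [map_smul_eq_mul, RCLike.norm_ofReal, abs_of_nonneg (sub_nonneg.2 h1)]
    exact mul_le_mul_of_nonneg_right (by linarith) (apply_nonneg _ _)

end Euler

end Resolvent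

/-! ### Dissipative relations in complete locally convex spaces -/

section LocallyConvex

variable {𝕜 X ι : Type*} [RCLike 𝕜] [AddCommGroup X] [Module 𝕜 X]

/-- Dissipativity of a linear relation with respect to a family of seminorms. -/
def IsDissipativeRelation (p : SeminormFamily 𝕜 X ι) (G : Submodule 𝕜 (X × X)) : Prop :=
  ∀ lam : ℝ, 0 < lam → ∀ x y, (x, y) ∈ G → ∀ i, lam * p i x ≤ p i ((lam : 𝕜) • x - y)

theorem WithSeminorms.eq_zero_of_forall [TopologicalSpace X] [T1Space X]
    {p : SeminormFamily 𝕜 X ι} (hp : WithSeminorms p) {x : X} (h : ∀ i, p i x = 0) : x = 0 := by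
  by_contra hx
  obtain ⟨i, hi⟩ := hp.separating_of_T1 x hx
  exact hi (h i)

theorem WithSeminorms.exists_mem_seminorm_sub_lt [TopologicalSpace X] {p : SeminormFamily 𝕜 X ι}
    (hp : WithSeminorms p) {D : Set X} (hD : Dense D) (i : ι) (x : X) {ε : ℝ} (hε : 0 < ε) :
    ∃ z ∈ D, p i (x - z) < ε := by
  have := hp.topologicalAddGroup
  have hc : Continuous fun z => p i (x - z) :=
    (hp.continuous_seminorm i).comp (continuous_const.sub continuous_id)
  obtain ⟨z, hzD, hz⟩ := hD.exists_mem_open (isOpen_Iio.preimage hc) ⟨x, by simpa using hε⟩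
  exact ⟨z, hzD, hz⟩

theorem WithSeminorms.continuous_of_seminorm_apply_le [TopologicalSpace X]
    {p : SeminormFamily 𝕜 X ι} (hp : WithSeminorms p) {L : X →ₗ[𝕜] X}
    (hL : ∀ i x, p i (L x) ≤ p i x) : Continuous L := by
  refine continuous_iff_continuousAt.2 fun x => (hp.tendsto_nhds _ _).2 fun i ε hε => ?_
  filter_upwards [(hp.tendsto_nhds id x).1 tendsto_id i ε hε] with y hy
  rw [← map_sub]
  exact (hL i _).trans_lt hy

theorem IsDissipativeRelation.topologicalClosure [TopologicalSpace X] [IsTopologicalAddGroup X]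
    [ContinuousSMul 𝕜 X] {p : SeminormFamily 𝕜 X ι} (hp : WithSeminorms p)
    {G : Submodule 𝕜 (X × X)} (hG : IsDissipativeRelation p G) :
    IsDissipativeRelation p G.topologicalClosure := by
  intro lam hlam x y hxy i
  have hc := hp.continuous_seminorm i
  have h : IsClosed {z : X × X | lam * p i z.1 ≤ p i ((lam : 𝕜) • z.1 - z.2)} :=
    isClosed_le (continuous_const.mul (hc.comp continuous_fst))
      (hc.comp ((continuous_fst.const_smul _).sub continuous_snd))
  exact closure_minimal (s := (G : Set (X × X))) (fun z hz => hG lam hlam z.1 z.2 hz i) h hxy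

/-- For `(z, w)` in `G`, dissipativity is applied to `(z, w + lam y)`. Dividing by `lam` and letting
`lam → ∞` removes `w` and leaves `p z ≤ p (z - y)`. Choosing `z` close to `y` gives `p y ≤ 2 p (y -
z)`, which is arbitrarily small. -/
theorem IsDissipativeRelation.eq_zero [TopologicalSpace X] [T1Space X]
    {p : SeminormFamily 𝕜 X ι} (hp : WithSeminorms p)
    {G : Submodule 𝕜 (X × X)} (hG : IsDissipativeRelation p G)
    (hd : Dense {x | ∃ y, (x, y) ∈ G}) {y : X} (hy : (0, y) ∈ G) : y = 0 := by
  refine hp.eq_zero_of_forall fun i => le_antisymm ?_ (apply_nonneg _ _)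
  have key : ∀ z w, (z, w) ∈ G → p i z ≤ p i (z - y) := fun z w hzw => by
    have h : ∀ n : ℕ, p i z ≤ p i (z - y) + (1 / ((n : ℝ) + 1)) * p i w := fun n => by
      set r : ℝ := 1 / ((n : ℝ) + 1) with hr
      have hr0 : 0 < r := Nat.one_div_pos_of_nat
      have h1 := hG r⁻¹ (inv_pos.2 hr0) _ _ (G.add_mem hzw (G.smul_mem ((r⁻¹ : ℝ) : 𝕜) hy)) i
      have h2 : ((r⁻¹ : ℝ) : 𝕜) • (z + ((r⁻¹ : ℝ) : 𝕜) • (0 : X)) - (w + ((r⁻¹ : ℝ) : 𝕜) • y) =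
          ((r⁻¹ : ℝ) : 𝕜) • (z - y) - w := by simp only [smul_zero, add_zero, smul_sub]; abel
      simp only [Prod.smul_fst, Prod.smul_snd] at h1
      rw [h2, smul_zero, add_zero] at h1
      have h3 := h1.trans (map_sub_le_add (p i) _ _)
      rw [map_smul_eq_mul, RCLike.norm_ofReal, abs_of_pos (inv_pos.2 hr0)] at h3
      have h4 := mul_le_mul_of_nonneg_left h3 hr0.le
      rwa [mul_add, mul_inv_cancel_left₀ hr0.ne', mul_inv_cancel_left₀ hr0.ne'] at h4
    have ht : Tendsto (fun n : ℕ => p i (z - y) + (1 / ((n : ℝ) + 1)) * p i w) atTop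
        (𝓝 (p i (z - y) + 0 * p i w)) :=
      tendsto_const_nhds.add (tendsto_one_div_add_atTop_nhds_zero_nat.mul_const _)
    simpa using ge_of_tendsto' ht h
  refine le_of_forall_pos_le_add fun ε hε => ?_
  obtain ⟨z, ⟨w, hzw⟩, hz⟩ := hp.exists_mem_seminorm_sub_lt hd i y (half_pos hε)
  have h1 := key z w hzw
  have h2 := map_add_le_add (p i) (y - z) z
  rw [map_sub_rev] at h1
  rw [sub_add_cancel] at h2
  linarith

/-- Dissipativity is the bound `p x ≤ lam⁻¹ p (lam x - y)`. It makes the inverse well defined and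
continuous on the dense range, so it extends by completeness; the graph condition is closed and
survives the extension. -/
theorem IsDissipativeRelation.exists_resolvent [UniformSpace X] [IsUniformAddGroup X]
    [ContinuousSMul 𝕜 X] [CompleteSpace X] [T2Space X]
    {p : SeminormFamily 𝕜 X ι} (hp : WithSeminorms p)
    {G : Submodule 𝕜 (X × X)} (hG : IsDissipativeRelation p G) {lam : ℝ} (hlam : 0 < lam)
    (hr : Dense {z | ∃ x y, (x, y) ∈ G ∧ (lam : 𝕜) • x - y = z}) :
    ∃ R : X →ₗ[𝕜] X, ∀ z, (R z, (lam : 𝕜) • R z - z) ∈ G.topologicalClosure := by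
  let f : G →ₗ[𝕜] X :=
    ((lam : 𝕜) • LinearMap.fst 𝕜 X X - LinearMap.snd 𝕜 X X) ∘ₗ G.subtype
  have hf : ∀ g : G, f g = (lam : 𝕜) • g.1.1 - g.1.2 := fun _ => rfl
  have hb : ∀ (g : G) i, p i g.1.1 ≤ lam⁻¹ * p i (f g) := fun g i => by
    rw [← div_eq_inv_mul, le_div_iff₀' hlam]
    exact hG lam hlam _ _ g.2 i
  have hinj : Function.Injective f := by
    refine (injective_iff_map_eq_zero f).2 fun g hg => ?_
    have h1 : g.1.1 = 0 := hp.eq_zero_of_forall fun i => le_antisymm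
      (by simpa [hg] using hb g i) (apply_nonneg _ _)
    have h2 : g.1.2 = 0 := by simpa [hf, h1] using hg
    exact Subtype.ext (Prod.ext h1 h2)
  let e := LinearEquiv.ofInjective f hinj
  let R₀ : f.range →ₗ[𝕜] X := LinearMap.fst 𝕜 X X ∘ₗ G.subtype ∘ₗ e.symm.toLinearMap
  have hR₀ : ∀ g : G, R₀ (e g) = g.1.1 := fun g => by simp [R₀]
  have hle : ∀ z i, p i (R₀ z) ≤ lam⁻¹ * p i z := fun z i => by
    obtain ⟨g, rfl⟩ := e.surjective z
    rw [hR₀]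
    exact hb g i
  have hcont : Continuous R₀ := by
    refine continuous_of_continuousAt_zero R₀ ?_
    rw [ContinuousAt, map_zero]
    refine (hp.tendsto_nhds _ _).2 fun i ε hε => ?_
    have hc : Continuous fun z : f.range => lam⁻¹ * p i z :=
      continuous_const.mul ((hp.continuous_seminorm i).comp continuous_subtype_val)
    filter_upwards [(hc.tendsto 0).eventually (gt_mem_nhds (by simpa using hε))] with z hz
    rw [sub_zero]
    exact (hle z i).trans_lt hz
  have : IsUniformAddGroup f.range := inferInstanceAs (IsUniformAddGroup f.range.toAddSubgroup)
  have hdense : DenseRange (f.range.subtypeL : f.range → X) := by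
    refine hr.mono ?_
    rintro _ ⟨x, y, hxy, rfl⟩
    exact ⟨⟨_, ⟨⟨(x, y), hxy⟩, rfl⟩⟩, rfl⟩
  have hind : IsUniformInducing (f.range.subtypeL : f.range → X) :=
    isUniformEmbedding_subtype_val.isUniformInducing
  let R : X →L[𝕜] X := ContinuousLinearMap.extend ⟨R₀, hcont⟩ f.range.subtypeL
  have hR : ∀ z : f.range, R z = R₀ z := fun z =>
    ContinuousLinearMap.extend_eq (f := ⟨R₀, hcont⟩) (e := f.range.subtypeL) hdense hind z
  refine ⟨R, fun z => ?_⟩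
  have hcl : IsClosed {z | (R z, (lam : 𝕜) • R z - z) ∈ G.topologicalClosure} :=
    G.isClosed_topologicalClosure.preimage
      (R.continuous.prodMk ((R.continuous.const_smul _).sub continuous_id))
  refine (hcl.closure_subset_iff.2 ?_) (hdense z)
  rintro _ ⟨z, rfl⟩
  obtain ⟨g, rfl⟩ := e.surjective z
  change (R (e g), (lam : 𝕜) • R (e g) - (e g : X)) ∈ G.topologicalClosure
  rw [hR, hR₀]
  have : (lam : 𝕜) • g.1.1 - (e g : X) = g.1.2 := by
    change (lam : 𝕜) • g.1.1 - f g = g.1.2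
    rw [hf, sub_sub_cancel]
  rw [this]
  exact G.le_topologicalClosure g.2

theorem IsDissipativeRelation.seminorm_le {p : SeminormFamily 𝕜 X ι} {G : Submodule 𝕜 (X × X)}
    (hG : IsDissipativeRelation p G) {s : ℝ} (hs : 0 < s) {x y : X} (h : (x, y) ∈ G) (i : ι) :
    p i x ≤ p i (x - (s : 𝕜) • y) := by
  have hs' : (s : 𝕜) ≠ 0 := RCLike.ofReal_ne_zero.2 hs.ne'
  have h1 := mul_le_mul_of_nonneg_left (hG s⁻¹ (inv_pos.2 hs) _ _ h i) hs.le
  have h2 : x - (s : 𝕜) • y = (s : 𝕜) • (((s⁻¹ : ℝ) : 𝕜) • x - y) := by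
    rw [RCLike.ofReal_inv, smul_sub, smul_inv_smul₀ hs']
  rwa [mul_inv_cancel_left₀ hs.ne', ← abs_of_pos hs, ← RCLike.norm_ofReal (K := 𝕜),
    ← map_smul_eq_mul, RCLike.norm_ofReal, abs_of_pos hs, ← h2] at h1

/-- The resolvent is rescaled by `(1 - s G)⁻¹ = s⁻¹ (s⁻¹ - G)⁻¹`. Being a left inverse follows from
uniqueness: two solutions differ by a pair of the closed relation to which dissipativity applies
with right-hand side zero. -/
theorem IsDissipativeRelation.exists_resolventFamily [UniformSpace X] [IsUniformAddGroup X]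
    [ContinuousSMul 𝕜 X] [CompleteSpace X] [T2Space X]
    {p : SeminormFamily 𝕜 X ι} (hp : WithSeminorms p)
    {G : Submodule 𝕜 (X × X)} (hG : IsDissipativeRelation p G)
    (hr : ∀ lam : ℝ, 0 < lam → Dense {z | ∃ x y, (x, y) ∈ G ∧ (lam : 𝕜) • x - y = z}) :
    ∃ V : ℝ → Module.End 𝕜 X, IsResolventFamily G.topologicalClosure V ∧
      ∀ i s, 0 < s → ∀ y, p i (V s y) ≤ p i y := by
  have hG' := hG.topologicalClosure hp
  choose R hR using fun s : {s : ℝ // 0 < s} =>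
    hG.exists_resolvent hp (inv_pos.2 s.2) (hr s.1⁻¹ (inv_pos.2 s.2))
  let V : ℝ → Module.End 𝕜 X := fun s =>
    if hs : 0 < s then ((s⁻¹ : ℝ) : 𝕜) • R ⟨s, hs⟩ else 0
  have hV : ∀ s (hs : 0 < s) y, V s y = ((s⁻¹ : ℝ) : 𝕜) • R ⟨s, hs⟩ y := fun s hs y => by
    simp [V, hs]
  have hmem : ∀ s : ℝ, 0 < s → ∀ y,
      (V s y, (s : 𝕜)⁻¹ • (V s y - y)) ∈ G.topologicalClosure := fun s hs y => by
    have h := G.topologicalClosure.smul_mem ((s⁻¹ : ℝ) : 𝕜) (hR ⟨s, hs⟩ y)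
    rwa [Prod.smul_mk, ← hV, RCLike.ofReal_inv] at h
  have hsub : ∀ s : ℝ, 0 < s → ∀ y, V s y - (s : 𝕜) • (s : 𝕜)⁻¹ • (V s y - y) = y :=
    fun s hs y => by
      rw [smul_inv_smul₀ (RCLike.ofReal_ne_zero.2 hs.ne'), sub_sub_cancel]
  refine ⟨V, ⟨hmem, fun s hs x y hxy => ?_⟩, fun i s hs y => ?_⟩
  · refine sub_eq_zero.1 (hp.eq_zero_of_forall fun i => le_antisymm ?_ (apply_nonneg _ _))
    have h := hG'.seminorm_le hs (G.topologicalClosure.sub_mem (hmem s hs (x - (s : 𝕜) • y)) hxy) i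
    have e : V s (x - (s : 𝕜) • y) - x -
        (s : 𝕜) • ((s : 𝕜)⁻¹ • (V s (x - (s : 𝕜) • y) - (x - (s : 𝕜) • y)) - y) = 0 := by
      rw [smul_sub (s : 𝕜), smul_inv_smul₀ (RCLike.ofReal_ne_zero.2 hs.ne')]; abel
    simp only at h
    rwa [e, map_zero] at h
  · have h := hG'.seminorm_le hs (hmem s hs y) i
    rwa [hsub s hs] at h

end LocallyConvex

/-! ### The generated semigroup -/

section Generation

variable {𝕜 X ι : Type*} [RCLike 𝕜] [AddCommGroup X] [Module 𝕜 X]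
  {p : SeminormFamily 𝕜 X ι} {G : Submodule 𝕜 (X × X)} {V : ℝ → Module.End 𝕜 X}

theorem WithSeminorms.cauchySeq [UniformSpace X] [IsUniformAddGroup X] (hp : WithSeminorms p)
    {u : ℕ → X} (h : ∀ i ε, 0 < ε → ∃ N, ∀ n ≥ N, p i (u n - u N) < ε) : CauchySeq u := by
  rw [cauchySeq_iff_tendsto, uniformity_eq_comap_nhds_zero, tendsto_comap_iff, hp.tendsto_nhds]
  intro i ε hε
  obtain ⟨N, hN⟩ := h i (ε / 2) (half_pos hε)
  refine eventually_atTop.2 ⟨(N, N), fun mn hmn => ?_⟩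
  have h1 := hN mn.1 hmn.1
  have h2 := hN mn.2 hmn.2
  have h3 := map_sub_le_add (p i) (u mn.2 - u N) (u mn.1 - u N)
  rw [sub_sub_sub_cancel_right] at h3
  simp only [Function.comp_apply, Prod.map_fst, Prod.map_snd, sub_zero]
  linarith

theorem tendsto_const_mul_two_inv_pow (c : ℝ) :
    Tendsto (fun n : ℕ => c * (2 : ℝ)⁻¹ ^ n) atTop (𝓝 0) := by
  simpa using (tendsto_pow_atTop_nhds_zero_of_lt_one (r := (2 : ℝ)⁻¹) (by norm_num)
    (by norm_num)).const_mul c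

/-- For `x` in the domain, `V s x` lies in the domain of the square and tends to `x` as `s → 0`. -/
theorem IsResolventFamily.dense_domain_sq [TopologicalSpace X] (hp : WithSeminorms p)
    (hV : IsResolventFamily G V) (hVp : ∀ i s, 0 < s → ∀ y, p i (V s y) ≤ p i y)
    (hd : Dense {x | ∃ y, (x, y) ∈ G}) : Dense {x | ∃ y w, (x, y) ∈ G ∧ (y, w) ∈ G} := by
  refine Dense.of_closure (hd.mono ?_)
  rintro x ⟨y, hxy⟩
  have hlim : Tendsto (fun n : ℕ => V ((2 : ℝ)⁻¹ ^ n) x) atTop (𝓝 x) := by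
    refine (hp.tendsto_nhds _ _).2 fun i ε hε => ?_
    filter_upwards [(tendsto_const_mul_two_inv_pow (p i y)).eventually (gt_mem_nhds hε)] with n hn
    refine lt_of_le_of_lt ?_ hn
    rw [mul_comm]
    exact hV.seminorm_apply_sub_le (two_inv_pow_pos n) (hVp i _ (two_inv_pow_pos n)) hxy
  exact mem_closure_of_tendsto hlim (Eventually.of_forall fun n =>
    ⟨_, _, hV.map_mem (two_inv_pow_pos n) hxy, hV.mem _ (two_inv_pow_pos n) y⟩)

theorem IsResolventFamily.exists_tendsto_eulerApprox [UniformSpace X] [IsUniformAddGroup X]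
    [CompleteSpace X] (hp : WithSeminorms p)
    (hV : IsResolventFamily G V) (hVp : ∀ i s, 0 < s → ∀ y, p i (V s y) ≤ p i y)
    (hd : Dense {x | ∃ y, (x, y) ∈ G}) (t : ℝ≥0) (x : X) :
    ∃ z, Tendsto (fun n => eulerApprox V n t x) atTop (𝓝 z) := by
  refine cauchySeq_tendsto_of_complete (hp.cauchySeq fun i ε hε => ?_)
  obtain ⟨z, ⟨y, w, hzy, hyw⟩, hz⟩ := hp.exists_mem_seminorm_sub_lt
    (hV.dense_domain_sq hp hVp hd) i x (ε := ε / 3) (by positivity)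
  set c := p i y + 7 * t * p i w with hc
  have hc0 : 0 ≤ c := by positivity
  obtain ⟨N, hN⟩ := ((tendsto_const_mul_two_inv_pow c).eventually
    (gt_mem_nhds (show 0 < ε / 3 by positivity))).exists
  refine ⟨N, fun n hn => ?_⟩
  obtain ⟨j, rfl⟩ := Nat.exists_eq_add_of_le hn
  have h1 := seminorm_eulerApprox_add_sub_le hV (hVp i) N j t hzy hyw
  have h2 := seminorm_eulerApprox_le (hVp i) (N + j) t (x - z)
  have h3 := seminorm_eulerApprox_le (hVp i) N t (x - z)
  have h4 : c * (2⁻¹ ^ N - 2⁻¹ ^ (N + j)) ≤ c * 2⁻¹ ^ N :=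
    mul_le_mul_of_nonneg_left (sub_le_self _ (by positivity)) hc0
  have e : eulerApprox V (N + j) t x - eulerApprox V N t x =
      (eulerApprox V (N + j) t z - eulerApprox V N t z) +
        (eulerApprox V (N + j) t (x - z) - eulerApprox V N t (x - z)) := by
    rw [map_sub, map_sub]; abel
  rw [e]
  have h5 := map_add_le_add (p i) (eulerApprox V (N + j) t z - eulerApprox V N t z)
    (eulerApprox V (N + j) t (x - z) - eulerApprox V N t (x - z))
  have h6 := map_sub_le_add (p i) (eulerApprox V (N + j) t (x - z)) (eulerApprox V N t (x - z))
  linarith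

theorem WithSeminorms.tendsto_seminorm_sub [TopologicalSpace X] (hp : WithSeminorms p) {α : Type*}
    {l : Filter α} {u : α → X} {x : X} (h : Tendsto u l (𝓝 x)) (y : X) (i : ι) :
    Tendsto (fun a => p i (u a - y)) l (𝓝 (p i (x - y))) := by
  have := hp.topologicalAddGroup
  exact ((hp.continuous_seminorm i).tendsto _).comp (h.sub_const y)

/-- A linear relation with contractive resolvents and dense domain generates a contraction
semigroup on a complete locally convex space. -/
theorem IsResolventFamily.exists_semigroup [UniformSpace X] [IsUniformAddGroup X]
    [ContinuousSMul 𝕜 X] [CompleteSpace X] [T2Space X] (hp : WithSeminorms p)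
    (hV : IsResolventFamily G V) (hVp : ∀ i s, 0 < s → ∀ y, p i (V s y) ≤ p i y)
    (hd : Dense {x | ∃ y, (x, y) ∈ G}) :
    ∃ T : ℝ≥0 → X →ₗ[𝕜] X, IsStronglyContinuousSemigroup (inferInstance : TopologicalSpace X) T ∧
      (∀ i t x, p i (T t x) ≤ p i x) ∧
      ∀ i t x y z w, (x, y) ∈ G → (z, w) ∈ G →
        p i (T t x - x - ((t : ℝ) : 𝕜) • y) ≤ t * (2 * p i (y - z) + t * p i w) := by
  choose f hf using hV.exists_tendsto_eulerApprox hp hVp hd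
  let T : ℝ≥0 → X →ₗ[𝕜] X := fun t =>
    linearMapOfTendsto (f t) (fun n => eulerApprox V n t) (tendsto_pi_nhds.2 (hf t))
  have hT : ∀ t x, Tendsto (fun n => eulerApprox V n t x) atTop (𝓝 (T t x)) := hf
  have hle : ∀ i t x, p i (T t x) ≤ p i x := fun i t x =>
    le_of_tendsto' (((hp.continuous_seminorm i).tendsto _).comp (hT t x)) fun n =>
      seminorm_eulerApprox_le (hVp i) n t x
  have hcont : ∀ t, Continuous (T t) := fun t => hp.continuous_of_seminorm_apply_le (hle · t)
  have hself : ∀ i t x y, (x, y) ∈ G → p i (T t x - x) ≤ t * p i y := fun i t x y hxy =>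
    le_of_tendsto' (hp.tendsto_seminorm_sub (hT t x) x i) fun n =>
      seminorm_eulerApprox_sub_self_le hV (hVp i) n t hxy
  have hzero : T 0 = LinearMap.id := by
    refine LinearMap.ext fun x => tendsto_nhds_unique (hT 0 x) ?_
    simp [eulerApprox]
  have hadd : ∀ s u, T (s + u) = T s ∘ₗ T u := fun s u => by
    refine LinearMap.ext fun x => ?_
    -- The error in the discrete semigroup law is controlled only on the domain; density and
    -- continuity of both sides suffice.
    refine congrFun (Continuous.ext_on hd (hcont _) ((hcont s).comp (hcont u)) ?_) x
    rintro x ⟨y, hxy⟩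
    have hlim : Tendsto (fun n => eulerApprox V n (s + u) x) atTop (𝓝 (T s (T u x))) := by
      refine (hp.tendsto_nhds _ _).2 fun i ε hε => ?_
      have h3 : 0 < ε / 3 := by positivity
      filter_upwards [(tendsto_const_mul_two_inv_pow (p i y)).eventually (gt_mem_nhds h3),
        (hp.tendsto_nhds _ _).1 (hT u x) i _ h3,
        (hp.tendsto_nhds _ _).1 (hT s (T u x)) i _ h3] with n h4 h5 h6
      have h7 := seminorm_eulerApprox_comp_sub_le hV (hVp i) n s u hxy
      have h8 := seminorm_eulerApprox_le (hVp i) n s (eulerApprox V n u x - T u x)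
      have e : eulerApprox V n (s + u) x - T s (T u x) =
          (eulerApprox V n (s + u) x - eulerApprox V n s (eulerApprox V n u x)) +
            eulerApprox V n s (eulerApprox V n u x - T u x) +
            (eulerApprox V n s (T u x) - T s (T u x)) := by
        rw [map_sub]; abel
      rw [e]
      refine ((map_add_le_add (p i) _ _).trans
        (add_le_add_left (map_add_le_add (p i) _ _) _)).trans_lt ?_
      linarith
    exact tendsto_nhds_unique (hT _ x) hlim
  have hdiff : ∀ i s u x y, (x, y) ∈ G → p i (T s x - T u x) ≤ |(s : ℝ) - u| * p i y := by
    intro i s u x y hxy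
    wlog hus : u ≤ s generalizing s u
    · rw [map_sub_rev, abs_sub_comm]
      exact this u s (le_of_not_ge hus)
    obtain ⟨r, rfl⟩ := exists_add_of_le hus
    rw [hadd, LinearMap.comp_apply, ← map_sub]
    have := (hle i u _).trans (hself i r x y hxy)
    rwa [NNReal.coe_add, add_sub_cancel_left, abs_of_nonneg r.coe_nonneg]
  refine ⟨T, ⟨hzero, hadd, fun x => ?_⟩, hle, fun i t x y z w hxy hzw => ?_⟩
  · refine continuous_iff_continuousAt.2 fun u => (hp.tendsto_nhds _ _).2 fun i ε hε => ?_
    obtain ⟨z, ⟨y, hzy⟩, hz⟩ := hp.exists_mem_seminorm_sub_lt hd i x (ε := ε / 3) (by positivity)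
    have hc : Continuous fun s : ℝ≥0 => |(s : ℝ) - u| * p i y := by fun_prop
    have h0 : |(u : ℝ) - u| * p i y < ε / 3 := by simpa using hε
    filter_upwards [(hc.tendsto u).eventually (gt_mem_nhds h0)] with s hs
    have h1 := hdiff i s u z y hzy
    have h2 := hle i s (x - z)
    have h3 := hle i u (x - z)
    have e : T s x - T u x = (T s z - T u z) + (T s (x - z) - T u (x - z)) := by
      rw [map_sub, map_sub]; abel
    rw [e]
    have h4 := map_add_le_add (p i) (T s z - T u z) (T s (x - z) - T u (x - z))
    have h5 := map_sub_le_add (p i) (T s (x - z)) (T u (x - z))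
    linarith
  · have h1 := hp.tendsto_seminorm_sub ((hT t x).sub_const x) (((t : ℝ) : 𝕜) • y) i
    have h2 := (tendsto_const_mul_two_inv_pow (p i y)).const_add
      ((t : ℝ) * (2 * p i (y - z) + t * p i w))
    rw [add_zero] at h2
    refine le_of_tendsto_of_tendsto' h1 h2 fun n => ?_
    rw [mul_comm (p i y)]
    exact seminorm_eulerApprox_sub_sub_smul_le hV (hVp i) n t hxy hzw

/-- A derivative at zero of a contraction semigroup satisfies the dissipativity estimate. -/
theorem WithSeminorms.le_seminorm_sub_of_tendsto [TopologicalSpace X] (hp : WithSeminorms p)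
    {T : ℝ≥0 → X →ₗ[𝕜] X} (hle : ∀ i t x, p i (T t x) ≤ p i x) {x y : X}
    (h : Tendsto (fun s : ℝ≥0 => ((s : ℝ) : 𝕜)⁻¹ • (T s x - x)) (𝓝[>] 0) (𝓝 y)) (i : ι) :
    p i x ≤ p i (x - y) := by
  have h1 := hp.tendsto_seminorm_sub h x i
  rw [map_sub_rev (p i) x y]
  refine ge_of_tendsto h1 ?_
  filter_upwards [self_mem_nhdsWithin] with s hs
  have hs0 : (0 : ℝ) < s := hs
  have hs' : ((s : ℝ) : 𝕜) ≠ 0 := RCLike.ofReal_ne_zero.2 hs0.ne'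
  -- Before the limit, the reverse triangle inequality bounds the seminorm of this vector below by
  -- `(s⁻¹ + 1) p x - s⁻¹ p (T s x)`, hence by `p x`.
  have e : ((s : ℝ) : 𝕜)⁻¹ • (T s x - x) - x =
      (((s : ℝ)⁻¹ : ℝ) : 𝕜) • T s x - (((s : ℝ)⁻¹ + 1 : ℝ) : 𝕜) • x := by
    push_cast; module
  have h2 := map_add_le_add (p i) ((((s : ℝ)⁻¹ + 1 : ℝ) : 𝕜) • x - (((s : ℝ)⁻¹ : ℝ) : 𝕜) • T s x)
    ((((s : ℝ)⁻¹ : ℝ) : 𝕜) • T s x)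
  rw [e, map_sub_rev]
  rw [sub_add_cancel, map_smul_eq_mul, map_smul_eq_mul, RCLike.norm_ofReal, RCLike.norm_ofReal,
    abs_of_pos (by positivity), abs_of_pos (by positivity)] at h2
  have h3 := mul_le_mul_of_nonneg_left (hle i s x) (inv_pos.2 hs0).le
  linarith

/-- **Lumer–Phillips** for relations: the semigroup of `exists_semigroup` has generator `G`. -/
theorem IsResolventFamily.exists_semigroup_generator [UniformSpace X] [IsUniformAddGroup X]
    [ContinuousSMul 𝕜 X] [CompleteSpace X] [T2Space X] (hp : WithSeminorms p)
    (hV : IsResolventFamily G V) (hVp : ∀ i s, 0 < s → ∀ y, p i (V s y) ≤ p i y)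
    (hd : Dense {x | ∃ y, (x, y) ∈ G}) :
    ∃ T : ℝ≥0 → X →ₗ[𝕜] X, IsStronglyContinuousSemigroup (inferInstance : TopologicalSpace X) T ∧
      (∀ i t x, p i (T t x) ≤ p i x) ∧
      ∀ x y, (x, y) ∈ G ↔
        Tendsto (fun s : ℝ≥0 => ((s : ℝ) : 𝕜)⁻¹ • (T s x - x)) (𝓝[>] 0) (𝓝 y) := by
  obtain ⟨T, hT, hle, hder⟩ := hV.exists_semigroup hp hVp hd
  have hgen : ∀ x y, (x, y) ∈ G →
      Tendsto (fun s : ℝ≥0 => ((s : ℝ) : 𝕜)⁻¹ • (T s x - x)) (𝓝[>] 0) (𝓝 y) := by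
    refine fun x y hxy => (hp.tendsto_nhds _ _).2 fun i ε hε => ?_
    obtain ⟨z, ⟨w, hzw⟩, hz⟩ := hp.exists_mem_seminorm_sub_lt hd i y (ε := ε / 4) (by positivity)
    have hc : Continuous fun s : ℝ≥0 => (s : ℝ) * p i w := by fun_prop
    have h0 : ((0 : ℝ≥0) : ℝ) * p i w < ε / 2 := by simpa using hε
    filter_upwards [self_mem_nhdsWithin,
      nhdsWithin_le_nhds ((hc.tendsto 0).eventually (gt_mem_nhds h0))] with s hs hsw
    have hs0 : (0 : ℝ) < s := hs
    have hs' : ((s : ℝ) : 𝕜) ≠ 0 := RCLike.ofReal_ne_zero.2 hs0.ne'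
    have e : ((s : ℝ) : 𝕜)⁻¹ • (T s x - x) - y =
        (((s : ℝ)⁻¹ : ℝ) : 𝕜) • (T s x - x - ((s : ℝ) : 𝕜) • y) := by
      rw [RCLike.ofReal_inv, smul_sub _ (T s x - x), inv_smul_smul₀ hs']
    rw [e, map_smul_eq_mul, RCLike.norm_ofReal, abs_of_pos (inv_pos.2 hs0)]
    have h1 := mul_le_mul_of_nonneg_left (hder i s x y z w hxy hzw) (inv_pos.2 hs0).le
    rw [inv_mul_cancel_left₀ hs0.ne'] at h1
    linarith
  refine ⟨T, hT, hle, fun x y => ⟨hgen x y, fun h => ?_⟩⟩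
  -- The usual maximality argument: `u = x - V 1 (x - y)` has derivative `u` at zero along the
  -- semigroup, so the dissipativity estimate gives `p u ≤ p (u - u) = 0`. Thus `x = V 1 (x - y)` is
  -- in the domain of `G`.
  have hmem := hV.mem 1 one_pos (x - y)
  rw [RCLike.ofReal_one, inv_one, one_smul] at hmem
  have h1 := h.sub (hgen _ _ hmem)
  have h2 : Tendsto (fun s : ℝ≥0 => ((s : ℝ) : 𝕜)⁻¹ • (T s (x - V 1 (x - y)) - (x - V 1 (x - y))))
      (𝓝[>] 0) (𝓝 (y - (V 1 (x - y) - (x - y)))) := by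
    refine h1.congr fun s => ?_
    rw [← smul_sub, map_sub (T s) x]; congr 1; abel
  have h3 : x - V 1 (x - y) = 0 := hp.eq_zero_of_forall fun i => by
    have h4 := hp.le_seminorm_sub_of_tendsto hle h2 i
    have e : x - V 1 (x - y) - (y - (V 1 (x - y) - (x - y))) = 0 := by abel
    rw [e, map_zero] at h4
    exact le_antisymm h4 (apply_nonneg _ _)
  rw [← sub_eq_zero.1 h3, sub_sub_cancel] at hmem
  exact hmem

end Generation

/-! ### The Lumer–Phillips theorem in complete locally convex spaces -/

section LumerPhillips

variable {𝕜 X ι : Type*} [RCLike 𝕜] [AddCommGroup X] [Module 𝕜 X]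

theorem IsDissipativeRelation.exists_closure_generator [UniformSpace X] [IsUniformAddGroup X]
    [ContinuousSMul 𝕜 X] [CompleteSpace X] [T2Space X] {p : SeminormFamily 𝕜 X ι}
    (hp : WithSeminorms p) {A : X →ₗ.[𝕜] X} (hA : IsDissipativeRelation p A.graph)
    (hd : Dense (A.domain : Set X))
    (hr : ∀ lam : ℝ, 0 < lam →
      Dense {z | ∃ x y, (x, y) ∈ A.graph ∧ (lam : 𝕜) • x - y = z}) :
    ∃ (B : X →ₗ.[𝕜] X) (T : ℝ≥0 → X →ₗ[𝕜] X),
      IsClosureOf (inferInstance : TopologicalSpace X) A B ∧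
      IsStronglyContinuousSemigroup (inferInstance : TopologicalSpace X) T ∧
      IsGenerator (inferInstance : TopologicalSpace X) T B ∧
      ∀ i t x, p i (T t x) ≤ p i x := by
  obtain ⟨V, hV, hVp⟩ := hA.exists_resolventFamily hp hr
  have hd' : Dense {x | ∃ y, (x, y) ∈ A.graph.topologicalClosure} := hd.mono fun x hx =>
    ⟨A ⟨x, hx⟩, A.graph.le_topologicalClosure (A.mem_graph ⟨x, hx⟩)⟩
  obtain ⟨T, hT, hle, hgen⟩ := hV.exists_semigroup_generator hp hVp hd'
  have hB : A.graph.topologicalClosure.toLinearPMap.graph = A.graph.topologicalClosure := by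
    refine Submodule.toLinearPMap_graph_eq _ ?_
    rintro ⟨x, y⟩ hxy rfl
    exact (hA.topologicalClosure hp).eq_zero hp hd' hxy
  refine ⟨A.graph.topologicalClosure.toLinearPMap, T, ⟨⟨?_, ?_⟩, fun C hC => ?_⟩, hT, ?_, hle⟩
  · refine LinearPMap.le_of_le_graph ?_
    rw [hB]
    exact A.graph.le_topologicalClosure
  · rw [IsClosedOperator, hB]
    exact A.graph.isClosed_topologicalClosure
  · refine LinearPMap.le_of_le_graph ?_
    rw [hB]
    exact A.graph.topologicalClosure_minimal (LinearPMap.le_graph_iff.2 hC.1) hC.2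
  · intro x y
    rw [hB]
    exact hgen x y

theorem WithSeminorms.dense_of_forall_functional [TopologicalSpace X] {p : SeminormFamily 𝕜 X ι}
    (hp : WithSeminorms p) (S : Submodule 𝕜 X)
    (hS : ∀ f : X →ₗ[𝕜] 𝕜, Continuous f → (∀ x ∈ S, f x = 0) → f = 0) : Dense (S : Set X) := by
  let _ : Module ℝ X := .restrictScalars ℝ 𝕜 X
  have : IsScalarTower ℝ 𝕜 X := .restrictScalars ℝ 𝕜 X
  have := hp.topologicalAddGroup
  have := hp.continuousSMul
  have := hp.toLocallyConvexSpace
  intro x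
  by_contra hx
  rw [← S.topologicalClosure_coe] at hx
  have hconv : Convex ℝ (S.topologicalClosure : Set X) :=
    (S.topologicalClosure.restrictScalars ℝ).convex
  obtain ⟨f, u, hu, hux⟩ := RCLike.geometric_hahn_banach_closed_point (𝕜 := 𝕜) hconv
    S.isClosed_topologicalClosure hx
  have hf : ∀ a ∈ S, f a = 0 := fun a ha => by
    by_contra h
    -- If `f a ≠ 0`, the multiple `u (f a)⁻¹ a` lies in `S` and `f` takes the value `u` there,
    -- against the strict separation.
    have h1 := hu _ (S.le_topologicalClosure (S.smul_mem ((u : 𝕜) * (f a)⁻¹) ha))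
    rw [map_smul, smul_eq_mul, inv_mul_cancel_right₀ h, RCLike.ofReal_re] at h1
    exact h1.false
  have h0 : f x = 0 := LinearMap.congr_fun (hS f f.continuous hf) x
  have h1 := hu 0 (zero_mem _)
  rw [map_zero] at h1
  rw [h0] at hux
  exact (h1.trans hux).false

end LumerPhillips

/-! ### Generating systems and the submixed topology -/

section Submixed

variable {𝕜 X : Type*} [RCLike 𝕜] [AddCommGroup X] [Module 𝕜 X]

theorem IsGeneratingSystem.continuous {t : TopologicalSpace X} {Γ : Set (Seminorm 𝕜 X)}
    (hΓ : IsGeneratingSystem t Γ) {p : Seminorm 𝕜 X} (hp : p ∈ Γ) : Continuous p :=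
  hΓ.generates.continuous_seminorm ⟨p, hp⟩

/-- Continuity gives a bound by finitely many members of the system; directedness merges them into
one. -/
theorem IsGeneratingSystem.exists_le_smul {t : TopologicalSpace X} {Γ : Set (Seminorm 𝕜 X)}
    (hΓ : IsGeneratingSystem t Γ) {s : Seminorm 𝕜 X} (hs : Continuous s) :
    ∃ q ∈ Γ, ∃ C : ℝ≥0, s ≤ C • q := by
  have hfin : ∀ F : Finset Γ, ∃ q ∈ Γ, ∃ C : ℝ≥0,
      F.sup (fun p : Γ => (p : Seminorm 𝕜 X)) ≤ C • q := by
    intro F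
    induction F using Finset.cons_induction with
    | empty =>
      obtain ⟨q, hq⟩ := hΓ.nonempty
      exact ⟨q, hq, 0, by rw [Finset.sup_empty]; exact bot_le⟩
    | cons a F ha ih =>
      obtain ⟨q, hq, C, hC⟩ := ih
      obtain ⟨r, hr, D, haD, hqD⟩ := hΓ.directed a a.2 q hq
      refine ⟨r, hr, D ⊔ C * D, ?_⟩
      rw [Finset.sup_cons]
      refine sup_le (fun x => (haD x).trans ?_) fun x => (hC x).trans ?_
      · exact mul_le_mul_of_nonneg_right (NNReal.coe_le_coe.2 le_sup_left) (apply_nonneg r x)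
      · calc (C : ℝ) * q x ≤ C * (D * r x) := mul_le_mul_of_nonneg_left (hqD x) C.2
          _ = (C * D : ℝ≥0) * r x := by rw [NNReal.coe_mul, mul_assoc]
          _ ≤ _ := mul_le_mul_of_nonneg_right (NNReal.coe_le_coe.2 le_sup_right) (apply_nonneg r x)
  obtain ⟨F, C, -, hC⟩ := Seminorm.bound_of_continuous hΓ.generates s hs
  obtain ⟨q, hq, D, hD⟩ := hfin F
  refine ⟨q, hq, C * D, fun x => (hC x).trans ?_⟩
  calc (C : ℝ) * _ ≤ C * (D * q x) := mul_le_mul_of_nonneg_left (hD x) C.2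
    _ = (C * D : ℝ≥0) * q x := by rw [NNReal.coe_mul, mul_assoc]

/-- `r` is dominated by continuous seminorms up to arbitrarily small multiples of `N`. -/
def IsAlmostContinuous [TopologicalSpace X] (N r : Seminorm 𝕜 X) : Prop :=
  ∀ ε : ℝ, 0 < ε → ∃ s : Seminorm 𝕜 X, Continuous s ∧ ∀ x, r x ≤ s x + ε * N x

namespace IsAlmostContinuous

variable [TopologicalSpace X] {N r r' : Seminorm 𝕜 X}

theorem bot : IsAlmostContinuous N ⊥ := fun ε hε =>
  ⟨0, continuous_const, fun x => by
    have := apply_nonneg N x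
    simp only [Seminorm.bot_eq_zero, zero_apply]
    positivity⟩

theorem sup (h : IsAlmostContinuous N r) (h' : IsAlmostContinuous N r') :
    IsAlmostContinuous N (r ⊔ r') := fun ε hε => by
  obtain ⟨s, hs, hr⟩ := h ε hε
  obtain ⟨s', hs', hr'⟩ := h' ε hε
  refine ⟨s + s', hs.add hs', fun x => ?_⟩
  have := apply_nonneg s x
  have := apply_nonneg s' x
  rw [Seminorm.sup_apply, add_apply]
  exact sup_le (by linarith [hr x]) (by linarith [hr' x])

theorem finset_sup {ι : Type*} {p : ι → Seminorm 𝕜 X} (h : ∀ i, IsAlmostContinuous N (p i))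
    (F : Finset ι) : IsAlmostContinuous N (F.sup p) :=
  Finset.sup_induction bot (fun _ ha _ hb => ha.sup hb) fun i _ => h i

theorem of_le_smul (h : IsAlmostContinuous N r) {C : ℝ≥0} (hC : r' ≤ C • r) :
    IsAlmostContinuous N r' := fun ε hε => by
  -- Dividing by `C + 1` instead of `C` covers `C = 0`.
  have hC0 : (0 : ℝ) < C + 1 := by positivity
  obtain ⟨s, hs, hr⟩ := h (ε / (C + 1)) (by positivity)
  refine ⟨(C + 1) • s, hs.const_smul (C + 1), fun x => (hC x).trans ?_⟩
  have h1 : (C : ℝ) * r x ≤ (C + 1) * (s x + ε / (C + 1) * N x) :=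
    mul_le_mul (by linarith) (hr x) (apply_nonneg _ _) hC0.le
  have h2 : (C + 1) * (s x + ε / (C + 1) * N x) = (C + 1) * s x + ε * N x := by
    field_simp
  exact h1.trans_eq h2

/-- Weighted suprema of continuous seminorms bounded by `N`, with null weights. -/
theorem of_weights {p : ℕ → Seminorm 𝕜 X} {a : ℕ → ℝ≥0} (hp : ∀ n, Continuous (p n))
    (hN : ∀ n x, p n x ≤ N x) (ha : Tendsto a atTop (𝓝 0))
    (hr : ∀ x c, (∀ n, a n * p n x ≤ c) → r x ≤ c) : IsAlmostContinuous N r := fun ε hε => by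
  have hfin : ∀ n, ∃ s : Seminorm 𝕜 X, Continuous s ∧ ∀ k < n, ∀ x, a k * p k x ≤ s x := fun n => by
    induction n with
    | zero => exact ⟨0, continuous_const, fun k hk => absurd hk (Nat.not_lt_zero k)⟩
    | succ n ih =>
      obtain ⟨s, hs, h⟩ := ih
      refine ⟨s + a n • p n, hs.add ((hp n).const_smul (a n)), fun k hk x => ?_⟩
      change (a k : ℝ) * p k x ≤ s x + a n * p n x
      rcases Nat.lt_succ_iff_lt_or_eq.1 hk with hk | rfl
      · have : 0 ≤ (a n : ℝ) * p n x := by positivity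
        linarith [h k hk x]
      · linarith [apply_nonneg s x]
  -- From `M` on the weights are at most `ε`, so these terms are at most `ε N`; the finitely many
  -- earlier ones are dominated by a continuous sum.
  obtain ⟨M, hM⟩ := eventually_atTop.1
    ((NNReal.tendsto_coe.2 ha).eventually (ge_mem_nhds (by simpa using hε)))
  obtain ⟨s, hs, h⟩ := hfin M
  refine ⟨s, hs, fun x => hr x _ fun n => ?_⟩
  have hNx := apply_nonneg N x
  have hsx := apply_nonneg s x
  rcases lt_or_ge n M with hn | hn
  · have := h n hn x
    have : 0 ≤ ε * N x := by positivity
    linarith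
  · have : (a n : ℝ) * p n x ≤ ε * N x :=
      mul_le_mul (hM n hn) (hN n x) (apply_nonneg _ _) hε.le
    linarith

end IsAlmostContinuous

end Submixed

/-- Up to a constant, `r` is bounded by a finite maximum of weighted suprema. Norming of `Γ` bounds
every `p_n` by the norm, which controls the tails. -/
theorem IsGeneratingSystem.isAlmostContinuous_of_submixed {𝕜 X : Type*} [RCLike 𝕜]
    [NormedAddCommGroup X] [NormedSpace 𝕜 X] {τ : TopologicalSpace X} {Γ : Set (Seminorm 𝕜 X)}
    (hΓ : IsGeneratingSystem τ Γ) (hN : IsNorming Γ) {r : Seminorm 𝕜 X}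
    (hr : @Continuous X ℝ (submixedTopology Γ) _ r) :
    @IsAlmostContinuous 𝕜 X _ _ _ τ (normSeminorm 𝕜 X) r := by
  obtain ⟨F, C, -, hC⟩ := @Seminorm.bound_of_continuous 𝕜 X _ _ _ _ (submixedSeminorm Γ)
    (submixedTopology Γ) (@WithSeminorms.mk 𝕜 X _ _ _ _ _ (submixedTopology Γ) rfl) r hr
  refine @IsAlmostContinuous.of_le_smul 𝕜 X _ _ _ τ _ _ _
    (@IsAlmostContinuous.finset_sup 𝕜 X _ _ _ τ _ _ _ (fun i => ?_) F) _ hC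
  refine @IsAlmostContinuous.of_weights 𝕜 X _ _ _ τ _ _ i.1.1 i.1.2
    (fun n => hΓ.continuous (i.2.1 n)) (fun n x => (hN x).1 ⟨_, i.2.1 n, rfl⟩) i.2.2 fun x c h => ?_
  rw [(submixedSeminorm_apply hN i x).1]
  exact ciSup_le h

/-! ### Generation on Saks spaces -/

/-- If the dual operator is norm dissipative, then `lam - A` has `γ`-dense range. -/
theorem dense_range_of_isNormDissipative {𝕜 X : Type*} [RCLike 𝕜] [NormedAddCommGroup X]
    [NormedSpace 𝕜 X] {τ : TopologicalSpace X} {Γ : Set (Seminorm 𝕜 X)}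
    (hΓ : IsGeneratingSystem (mixedTopology 𝕜 τ) Γ) {A : X →ₗ.[𝕜] X}
    (hAdense : IsDenselyDefined (mixedTopology 𝕜 τ) A)
    (hA' : IsNormDissipative (𝕜 := 𝕜) (E := mixedDual 𝕜 τ) (mixedDualOperator τ A))
    {lam : ℝ} (hlam : 0 < lam) :
    @Dense X (mixedTopology 𝕜 τ) {z | ∃ x y, (x, y) ∈ A.graph ∧ (lam : 𝕜) • x - y = z} := by
  let S : Submodule 𝕜 X :=
    A.graph.map ((lam : 𝕜) • LinearMap.fst 𝕜 X X - LinearMap.snd 𝕜 X X)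
  have hS : (S : Set X) = {z | ∃ x y, (x, y) ∈ A.graph ∧ (lam : 𝕜) • x - y = z} := by
    ext z
    exact ⟨fun ⟨g, hg, h⟩ => ⟨g.1, g.2, hg, h⟩, fun ⟨x, y, hg, h⟩ => ⟨(x, y), hg, h⟩⟩
  rw [← hS]
  refine @WithSeminorms.dense_of_forall_functional 𝕜 X Γ _ _ _ (mixedTopology 𝕜 τ) _
    hΓ.generates S fun f hf hfS => ?_
  obtain ⟨g, hg, rfl⟩ := exists_mem_mixedDual τ f hf
  -- A functional annihilating the range of `lam - A` is an eigenvector of `A'` for `lam`, unless it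
  -- is zero; dissipativity then reads `lam ‖g‖ ≤ 0`.
  have hmem : ((⟨g, hg⟩, (lam : 𝕜) • ⟨g, hg⟩) : mixedDual 𝕜 τ × mixedDual 𝕜 τ) ∈
      (mixedDualOperator τ A).graph := by
    rw [mem_graph_mixedDualOperator τ A hAdense]
    intro x
    have h := hfS _ ⟨((x : X), A x), A.mem_graph x, rfl⟩
    have h' : g ((lam : 𝕜) • (x : X) - A x) = 0 := h
    rw [map_sub, map_smul, sub_eq_zero] at h'
    exact h'.symm
  obtain ⟨u, hu, hAu⟩ := (LinearPMap.mem_graph_iff _).1 hmem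
  have h := hA' lam hlam u _ rfl
  rw [hAu, hu, sub_self, map_zero] at h
  have h0 : ‖g‖ ≤ 0 := by
    by_contra hlt
    exact h.not_gt (mul_pos hlam (not_le.1 hlt))
  rw [norm_le_zero_iff.1 h0, map_zero]

theorem mainTheorem3 {𝕜 X : Type*} [RCLike 𝕜] [NormedAddCommGroup X] [NormedSpace 𝕜 X]
    [CompleteSpace X] (τ : TopologicalSpace X) (hX : IsCompleteSaksSpace 𝕜 τ)
    (Γγ : Set (Seminorm 𝕜 X)) (hΓγ : IsGeneratingSystem (mixedTopology 𝕜 τ) Γγ)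
    (A : X →ₗ.[𝕜] X) (hAdense : IsDenselyDefined (mixedTopology 𝕜 τ) A)
    (hA : IsDissipative Γγ A) (hA' : IsNormDissipative (𝕜 := 𝕜) (E := mixedDual 𝕜 τ) (mixedDualOperator τ A)) :
    ∃ (B : X →ₗ.[𝕜] X) (T : ℝ≥0 → X →ₗ[𝕜] X),
      (IsClosureOf (mixedTopology 𝕜 τ) A B ∧
        IsStronglyContinuousSemigroup (mixedTopology 𝕜 τ) T ∧
        IsGenerator (mixedTopology 𝕜 τ) T B ∧
        IsEquicontinuousFamily Γγ T) ∧
      (IsNorming Γγ → IsContractive T) ∧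
      (IsNorming Γγ → ∀ Γτ : Set (Seminorm 𝕜 X), IsGeneratingSystem τ Γτ → IsNorming Γτ →
        mixedTopology 𝕜 τ = submixedTopology Γτ →
        ∀ Γ : Set (Seminorm 𝕜 X), IsGeneratingSystem τ Γ → IsEquitightFamily Γ T) := by
  obtain ⟨hS, hcomplete⟩ := hX
  have hγ := (mixedTopology_isLeast hS).1
  have hγτ : mixedTopology 𝕜 τ ≤ τ := hγ.2.2.2.1
  have hgroup := mixedTopology_isTopologicalAddGroup 𝕜 τ
  have hunif : @IsUniformAddGroup X
      (@IsTopologicalAddGroup.rightUniformSpace X _ (mixedTopology 𝕜 τ) hgroup) _ :=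
    @isUniformAddGroup_of_addCommGroup X _ (mixedTopology 𝕜 τ) hgroup
  have hdiss : IsDissipativeRelation (fun p : Γγ => (p : Seminorm 𝕜 X)) A.graph := by
    intro lam hlam x y hxy p
    obtain ⟨u, rfl, rfl⟩ := (LinearPMap.mem_graph_iff A).1 hxy
    exact hA lam hlam u p p.2
  obtain ⟨B, T, hB, hT, hgen, hle⟩ := @IsDissipativeRelation.exists_closure_generator 𝕜 X Γγ _ _ _
    (@IsTopologicalAddGroup.rightUniformSpace X _ (mixedTopology 𝕜 τ) hgroup) hunif hγ.2.1
    hcomplete (t2Space_antitone hγτ hS.t2) _ hΓγ.generates A hdiss hAdense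
    fun lam hlam => dense_range_of_isNormDissipative hΓγ hAdense hA' hlam
  refine ⟨B, T, ⟨hB, hT, hgen, fun p hp => ⟨p, hp, 1, fun t x => ?_⟩⟩, fun hN t x => ?_,
    fun _ Γτ hΓτ hN hsub Γ hΓ ε hε p hp => ?_⟩
  · rw [NNReal.coe_one, one_mul]
    exact hle ⟨p, hp⟩ t x
  · refine (hN (T t x)).2 ?_
    rintro _ ⟨p, hp, rfl⟩
    exact (hle ⟨p, hp⟩ t x).trans ((hN x).1 ⟨p, hp, rfl⟩)
  -- The seminorm `p` need not be contracted by `T t`, so it is first dominated by `C q` with `q ∈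
  -- Γγ`, which is. Only then is `C q` estimated by a `τ`-continuous seminorm plus `ε ‖·‖`, now at
  -- `x`, uniformly in `t`.
  · obtain ⟨q, hq, C, hpq⟩ := hΓγ.exists_le_smul (continuous_le_dom hγτ (hΓ.continuous hp))
    have hqc : @Continuous X ℝ (submixedTopology Γτ) _ q := hsub ▸ hΓγ.continuous hq
    obtain ⟨s, hs, hr⟩ := @IsAlmostContinuous.of_le_smul 𝕜 X _ _ _ τ _ _ (C • q)
      (hΓτ.isAlmostContinuous_of_submixed hN hqc) C le_rfl ε hε
    obtain ⟨q', hq', D, hD⟩ := hΓ.exists_le_smul hs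
    refine ⟨q', hq', D, fun t x => (hpq (T t x)).trans ?_⟩
    calc (C : ℝ) * q (T t x) ≤ C * q x := mul_le_mul_of_nonneg_left (hle ⟨q, hq⟩ t x) C.2
      _ ≤ s x + ε * ‖x‖ := hr x
      _ ≤ D * q' x + ε * ‖x‖ := add_le_add_left (hD x) _
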